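/- Let $a,a^\dagger$ be the lowering and raising operators of a single bosonic mode with Fock states $|n\rangle$, $D(\alpha)=\exp(\alpha a^\dagger-\alpha^*a)$ and $|\alpha,n\rangle=D(\alpha)|n\rangle$. For $-1<r<1$ put $$\lambda_r^{(n)}=\frac{2(-1)^n(1-r)^n}{\pi(1+r)(1+r)^n},\qquad T_r(\alpha)=\sum_{n\ge0}\lambda_r^{(n)}|\alpha,n\rangle\langle\alpha,n|,\qquad \bar T_r=T_{-r},$$ and let $X^{(N)}=P_NXP_N$, where $P_N=\sum_{i<N}|i\rangle\langle i|$, $N\ge1$ (the matrix elements of $T_r(\alpha)$ are absolutely convergent series). Let $\rho$ be a density operator and $\mathcal A\subset\mathbb C$ a measurable region with area $0<|\mathcal A|<\infty$; let $A=\kappa|\mathcal A|$, where $\kappa>0$ fixes the unit of phase-space area. An outcome $(n,\alpha)$ is drawn by choosing $\alpha$ uniformly in $\mathcal A$ and then $n$ with probability $\langle\alpha,n|\rho|\alpha,n\rangle$; this is a probability distribution. The PNR snapshot is $\sigma(n,\alpha)=A\,\lambda_r^{(n)}\bar T_r^{(N)}(\alpha)$ if $n<N$, and $0$ if $n\ge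 N$. For $r=0$ also allow the photon-parity snapshot, which is $A\,\lambda_0^{(n)}\bar T_0^{(N)}(\alpha)$ for all $n$. Let $\sigma_T$ be the average of $T$ independent snapshots, and let $$\tilde\rho=\mathbb E\,\sigma=\kappa\int_{\mathcal A}d^2\alpha\sum_{n}\langle\alpha,n|\rho|\alpha,n\rangle\,\lambda_r^{(n)}\,\bar T_r^{(N)}(\alpha)$$ be the truncated expansion (the sum is over $n<N$ for PNR and over all $n$ for parity). Let $\|\cdot\|$ be the operator norm and $\epsilon,\delta\in(0,1)$. 1. (Shadow norms.) For all outcomes, $\|\sigma(n,\alpha)\|\le A|\lambda_{-|r|}^{(N)}\lambda_{|r|}^{(0)}|$ and $\|\sigma(n,\alpha)-\tilde\rho\|\le2A|\lambda_{-|r|}^{(N)}\lambda_{|r|}^{(0)}|$; if $A\ge1$, also $$\|\sigma(n,\alpha)-\rho^{(N)}\|\le R:=\frac{2A|\lambda_{-|r|}^{(N)}|}{\pi(1+|r|)}+A .$$ Moreover $$\nu^2=\big\|\mathbb E\,\sigma^2\big\|\le A^2|\lambda_{|r|}^{(0)}\lambda_{-|r|}^{(N)}|^2=V:=\frac{16A^2}{\pi^4(1-|r|^2)^2}\Big(\frac{1+|r|}{1-|r|}\Big)^{2N}.$$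 2. (Sample size.) Let $S_r(N,A)=\frac{2N^2(V+R\epsilon/2N)}{\epsilon^2}\log\frac{2N}{\delta}$. If $T\ge S_r(N,A)$, then $\Pr(\|\sigma_T-\tilde\rho\|\le\epsilon)\ge1-\delta$, and hence $\Pr(\|\sigma_T-\rho^{(N)}\|\le\epsilon+\|\tilde\rho-\rho^{(N)}\|)\ge1-\delta$. 3. (Growth.) For $A=cN$ with $c>0$ fixed, as $N\to\infty$, $$S_r(N,cN)\sim\frac{32\,c^2N^4}{\pi^4\epsilon^2(1-|r|^2)^2}\Big(\frac{1+|r|}{1-|r|}\Big)^{2N}\log\frac{2N}{\delta}.$$ 4. ($r=0$: photon parity or PNR.) For $A\ge1$ and $N\ge1$, $\frac14Q\le S_0(N,A)\le2Q$ with $Q=\frac{N^2A^2}{\epsilon^2}\log\frac{2N}{\delta}$; and $S_0(N,cN)=O(N^4\log N)$. 5. ($0<|r|<1$.) Here $\frac{1+|r|}{1-|r|}>1$ and $S_r(N,cN)=\Theta\big(N^4\log N\,(\frac{1+|r|}{1-|r|})^{2N}\big)$: the bound grows exponentially in $N$. 6. (Heterodyne limit.) As $r\to-1^+$, $\bar T_r^{(N)}(\alpha)\to\frac1\pi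 P_N|\alpha\rangle\langle\alpha|P_N$, where $|\alpha\rangle=|\alpha,0\rangle$, and $S_r(N,A)\to\infty$ for fixed $N\ge1$, $A>0$. If $r_N>-1$ and $r_N\to-1$ as $N\to\infty$, then $K^N=o(S_{r_N}(N,cN))$ for every $K$. -/

import Mathlib

open MeasureTheory Filter Asymptotics
open scoped Topology ENNReal Nat Matrix.Norms.L2Operator

namespace PNR

noncomputable section

/-! ### Fock space, ladder operators, displaced Fock states -/

/-- The Hilbert space of a single bosonic mode, `ℓ²(ℕ, ℂ)`. -/
abbrev Fock : Type := lp (fun _ : ℕ => ℂ) 2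

/-- The Fock (photon-number) state `|n⟩`. -/
def fock (n : ℕ) : Fock := lp.single 2 n (1 : ℂ)

/-- The inclusion of the finite linear combinations of Fock states into the Hilbert space. -/
def toFock : (ℕ →₀ ℂ) →ₗ[ℂ] Fock := Finsupp.linearCombination ℂ fock

/-- The lowering operator, `a|n⟩ = √n |n-1⟩` (and `a|0⟩ = 0`), on finite combinations. -/
def lowering : Module.End ℂ (ℕ →₀ ℂ) :=
  Finsupp.linearCombination ℂ (fun n : ℕ => Finsupp.single (n - 1) ((Real.sqrt n : ℝ) : ℂ))

/-- The raising operator, `a†|n⟩ = √(n+1) |n+1⟩`, on finite combinations. -/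
def raising : Module.End ℂ (ℕ →₀ ℂ) :=
  Finsupp.linearCombination ℂ (fun n : ℕ => Finsupp.single (n + 1) ((Real.sqrt (n + 1) : ℝ) : ℂ))

/-- The `k`-th term `(α a† - α* a)^k |n⟩ / k!` of the exponential series of
`D(α)|n⟩ = exp (α a† - α* a) |n⟩`. -/
def displacementTerm (α : ℂ) (n k : ℕ) : Fock :=
  ((k ! : ℂ)⁻¹) • toFock (((α • raising - (starRingEnd ℂ α) • lowering) ^ k) (Finsupp.single n 1))

/-- The displaced Fock state `|α, n⟩ = D(α)|n⟩`. -/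
def displacedFock (α : ℂ) (n : ℕ) : Fock := ∑' k : ℕ, displacementTerm α n k

/-! ### `T`-operators -/

/-- The eigenvalue `λ_r^{(n)} = 2 (-1)^n (1-r)^n / (π (1+r) (1+r)^n)`. -/
def eig (r : ℝ) (n : ℕ) : ℝ :=
  2 * (-1) ^ n * (1 - r) ^ n / (Real.pi * (1 + r) * (1 + r) ^ n)

/-- The `n`-th term of the matrix element `⟨i| T_r(α, α*) |j⟩`, where
`T_r(α, α*) = ∑ₙ λ_r^{(n)} |α, n⟩⟨α, n|`. -/
def tTerm (r : ℝ) (α : ℂ) (i j n : ℕ) : ℂ :=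
  (eig r n : ℂ) * (inner ℂ (fock i) (displacedFock α n) * inner ℂ (displacedFock α n) (fock j))

/-- The truncated operator `P_N T_r(α, α*) P_N` as an `N × N` matrix. -/
def tMatrix (r : ℝ) (N : ℕ) (α : ℂ) : Matrix (Fin N) (Fin N) ℂ :=
  Matrix.of fun i j => ∑' n : ℕ, tTerm r α i j n

/-- The truncated dual operator `P_N T̄_r(α, α*) P_N`, where `T̄_r = T_{-r}`. -/
def dualMatrix (r : ℝ) (N : ℕ) (α : ℂ) : Matrix (Fin N) (Fin N) ℂ := tMatrix (-r) N α

/-! ### States, measurement statistics, shadows -/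

/-- Density operators: positive, of trace one. -/
structure IsDensityOperator (ρ : Fock →L[ℂ] Fock) : Prop where
  isPositive : ρ.IsPositive
  trace_eq_one : HasSum (fun n : ℕ => (inner ℂ (fock n) (ρ (fock n))).re) 1

/-- `P_N ρ P_N` as an `N × N` matrix. -/
def truncState (N : ℕ) (ρ : Fock →L[ℂ] Fock) : Matrix (Fin N) (Fin N) ℂ :=
  Matrix.of fun i j => inner ℂ (fock i) (ρ (fock j))

/-- The probability `⟨n, α| ρ |n, α⟩` of detecting `n` photons after the displacement by `α`. -/
def photonProb (ρ : Fock →L[ℂ] Fock) (n : ℕ) (α : ℂ) : ℝ :=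
  (inner ℂ (displacedFock α n) (ρ (displacedFock α n))).re

/-- The law of one measurement outcome `(n, α)`: the displacement `α` is uniform in the region `𝒜`,
and then `n` photons are detected with probability `⟨n, α| ρ |n, α⟩`. -/
def outcomeLaw (ρ : Fock →L[ℂ] Fock) (𝒜 : Set ℂ) : Measure (ℕ × ℂ) :=
  ((Measure.count : Measure ℕ).prod (ProbabilityTheory.cond volume 𝒜)).withDensity
    fun x => ENNReal.ofReal (photonProb ρ x.1 x.2)

/-- The snapshot `A λ_r^{(n)} P_N T̄_r(α, α*) P_N` of the outcome `(n, α)`; outcomes with `n ≥ M`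
are discarded, that is, contribute `0`. With `M = N` this is the PNR shadow. With `r = 0` and
`M = ⊤` it depends on `n` only through the parity `(-1)^n`: the photon-parity shadow. -/
def snapshot (A r : ℝ) (N : ℕ) (M : ℕ∞) (x : ℕ × ℂ) : Matrix (Fin N) (Fin N) ℂ :=
  open Classical in
  if (x.1 : ℕ∞) < M then (A * eig r x.1) • dualMatrix r N x.2 else 0

/-- The shadow of size `T`, the average of `T` snapshots. -/
def shadow (A r : ℝ) (N : ℕ) (M : ℕ∞) {T : ℕ} (x : Fin T → ℕ × ℂ) : Matrix (Fin N) (Fin N) ℂ :=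
  (T : ℝ)⁻¹ • ∑ i, snapshot A r N M (x i)

/-- The expansion of the state in dual operators, truncated to the region `𝒜`, to `N` levels and to
photon numbers `n < M`:
`κ ∫_𝒜 d²α ∑_{n < M} ⟨n, α| ρ |n, α⟩ λ_r^{(n)} P_N T̄_r(α, α*) P_N`. -/
def truncExpansion (κ r : ℝ) (N : ℕ) (M : ℕ∞) (ρ : Fock →L[ℂ] Fock) (𝒜 : Set ℂ) :
    Matrix (Fin N) (Fin N) ℂ :=
  open Classical in
  κ • ∫ α in 𝒜, (∑' n : ℕ, if (n : ℕ∞) < M then photonProb ρ n α * eig r n else 0) •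
    dualMatrix r N α

/-! ### The bounds -/

/-- The bound on the shadow norm `R`. -/
def rangeBound (A r : ℝ) (N : ℕ) : ℝ :=
  2 * A * |eig (-|r|) N| / (Real.pi * (1 + |r|)) + A

/-- The bound on the shadow norm `ν²`. -/
def varianceBound (A r : ℝ) (N : ℕ) : ℝ :=
  16 * A ^ 2 / (Real.pi ^ 4 * (1 - |r| ^ 2) ^ 2) * ((1 + |r|) / (1 - |r|)) ^ (2 * N)

/-- The sample size `2 N² (ν² + R ε / (2 N)) / ε² · log (2 N / δ)` at the above bounds. -/
def sampleBound (A r : ℝ) (N : ℕ) (ε δ : ℝ) : ℝ :=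
  2 * (N : ℝ) ^ 2 * (varianceBound A r N + rangeBound A r N * ε / (2 * N)) / ε ^ 2 *
    Real.log (2 * N / δ)

end

end PNR

/-!
# Shadow tomography of a bosonic mode by displaced photon counting

**Displaced Fock states.** The coefficients of the `k`-th term of the series for `D(α)|n⟩` are
bounded with an arbitrary geometric weight (`norm_displacementTerm_apply_le`), so the series
converges and `⟨i|α, n⟩` decays faster than any geometric sequence, in `i` and in `n`. Since
`α a† - α* a` is anti-Hermitian, a Cauchy product gives orthonormality, and `D(α)† = D(-α)` turns
orthonormality at `-α` into completeness at `α` (`displacedBasis`). The trace of `ρ` may therefore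
be computed in the displaced basis, which makes the outcome law a probability measure.

**Norm of the truncated operators.** For `p ≥ 1` the operator `D(α) (-p)^(a†a) D(α)†` is unbounded,
and bounding its positive and negative parts separately fails for large `α`. But its matrix elements
satisfy a two-term recurrence (`geomElem_succ`) that determines them from the vacuum element, whence
`D(α) (-p)^(a†a) D(α)† = e^(-(p² - 1)|α|²/(2p)) p^(a†a/2) U p^(a†a/2)`, where
`U = D(γ) (-1)^(a†a) D(γ)†` is a displaced parity operator, hence unitary (`geomElem_neg`). The
truncation to `N` levels thus has norm at most `p^(N-1)`, uniformly in `α`. For `p ≤ 1` Bessel's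
inequality gives norm at most `1`. This bounds all snapshots (`norm_snapshot_le`).

**Sample size.** The operator norm is at most the Frobenius norm, which is a Hilbert norm, and
bounded independent centred vectors in a Hilbert space satisfy a dimension-free Bernstein inequality
(`measure_norm_sum_ge_le`): by convexity of `cosh ∘ √`, the expectation of `cosh (l ‖s + X‖)` is at
most `cosh (l ‖s‖)` times a factor that depends only on the second moment and the bound of `X`. The
Frobenius norm costs at most a factor `N` in the variance and `√N` in the range, which the factors
`N²` in front of the variance bound and `N / 2` in front of the range bound absorb; as the range
bound may be smaller than `2 A |λ_{-|r|}^{(N)} λ_{|r|}^{(0)}|`, the improvement of the snapshot norm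
from `p^N` to `p^(N-1)` is needed here (`sqrt_mul_snapBound_le`).

The remaining claims compare explicit functions; the heterodyne limit is dominated convergence.
-/

namespace PNR

/-! ### Ladder operators and the displacement series -/

/-- The anti-Hermitian generator `α a† - α* a` of the displacement `D(α)`, on finite combinations of
Fock states. -/
noncomputable def gen (α : ℂ) : Module.End ℂ (ℕ →₀ ℂ) :=
  α • raising - (starRingEnd ℂ α) • lowering

theorem lowering_apply (v : ℕ →₀ ℂ) (i : ℕ) :
    lowering v i = ((Real.sqrt (i + 1) : ℝ) : ℂ) * v (i + 1) := by
  induction v using Finsupp.induction_linear with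
  | zero => simp
  | add f g hf hg => simp [hf, hg, mul_add]
  | single n z =>
    rcases n with _ | n
    · simp [lowering]
    · by_cases h : n = i
      · subst h; simp [lowering, mul_comm]
      · simp [lowering, h]

theorem raising_apply (v : ℕ →₀ ℂ) (i : ℕ) :
    raising v i = ((Real.sqrt i : ℝ) : ℂ) * v (i - 1) := by
  induction v using Finsupp.induction_linear with
  | zero => simp
  | add f g hf hg => simp [hf, hg, mul_add]
  | single n z =>
    rcases i with _ | i
    · simp [raising]
    · by_cases h : n = i
      · subst h; simp [raising, mul_comm]
      · simp [raising, h]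

theorem gen_apply (α : ℂ) (v : ℕ →₀ ℂ) (i : ℕ) :
    gen α v i = α * (((Real.sqrt i : ℝ) : ℂ) * v (i - 1)) -
      (starRingEnd ℂ α) * (((Real.sqrt (i + 1) : ℝ) : ℂ) * v (i + 1)) := by
  simp [gen, lowering_apply, raising_apply]

theorem sqrt_mul_self_cast {x : ℝ} (hx : 0 ≤ x) :
    ((Real.sqrt x : ℝ) : ℂ) * ((Real.sqrt x : ℝ) : ℂ) = (x : ℂ) := by
  rw [← Complex.ofReal_mul, Real.mul_self_sqrt hx]

/-- The canonical commutation relation, in the form `[a, α a† - α* a] = α`. -/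
theorem lowering_mul_gen (α : ℂ) : lowering * gen α = gen α * lowering + α • 1 := by
  refine LinearMap.ext fun v => Finsupp.ext fun i => ?_
  have h1 : ((Real.sqrt (i + 1) : ℝ) : ℂ) * ((Real.sqrt (i + 1) : ℝ) : ℂ) = (i : ℂ) + 1 := by
    rw [sqrt_mul_self_cast (by positivity)]; push_cast; rfl
  rcases i with _ | i
  · simp [lowering_apply, gen_apply]; ring
  · have h2 : ((Real.sqrt (i + 1) : ℝ) : ℂ) * ((Real.sqrt (i + 1) : ℝ) : ℂ) = (i : ℂ) + 1 := by
      rw [sqrt_mul_self_cast (by positivity)]; push_cast; rfl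
    simp only [Module.End.mul_apply, lowering_apply, gen_apply, LinearMap.add_apply,
      Finsupp.add_apply, LinearMap.smul_apply, Module.End.one_apply, Finsupp.smul_apply,
      smul_eq_mul, Nat.add_sub_cancel]
    push_cast at h1 ⊢
    linear_combination α * v (i + 1) * h1 - α * v (i + 1) * h2

theorem lowering_mul_gen_pow (α : ℂ) (k : ℕ) :
    lowering * gen α ^ (k + 1) = gen α ^ (k + 1) * lowering + ((k + 1 : ℂ) * α) • gen α ^ k := by
  induction k with
  | zero => simpa using lowering_mul_gen α
  | succ k ih =>
    rw [pow_succ (gen α) (k + 1), ← mul_assoc, ih, add_mul, mul_assoc, lowering_mul_gen, mul_add,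
      smul_mul_assoc, ← pow_succ, mul_smul_comm, mul_one, add_assoc, ← add_smul, mul_assoc]
    congr 2
    push_cast; ring

theorem toFock_apply (v : ℕ →₀ ℂ) (i : ℕ) : toFock v i = v i := by
  induction v using Finsupp.induction_linear with
  | zero => simp
  | add f g hf hg => simp [hf, hg]
  | single n z =>
    by_cases h : i = n
    · subst h; simp [toFock, fock]
    · simp [toFock, fock, h]

theorem inner_fock (i : ℕ) (x : Fock) : inner ℂ (fock i) x = x i := by
  simp [fock, lp.inner_single_left]

theorem inner_fock_right (i : ℕ) (x : Fock) : inner ℂ x (fock i) = (starRingEnd ℂ) (x i) := by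
  rw [← inner_conj_symm, inner_fock]

theorem fock_apply (n i : ℕ) : fock n i = if i = n then 1 else 0 := by
  simp [fock, Pi.single_apply]

theorem toFock_single_one (n : ℕ) : toFock (Finsupp.single n 1) = fock n := by
  simp [toFock]

theorem inner_toFock_raising (u v : ℕ →₀ ℂ) :
    inner ℂ (toFock (raising u)) (toFock v) = inner ℂ (toFock u) (toFock (lowering v)) := by
  induction u using Finsupp.induction_linear with
  | zero => simp
  | add f g hf hg => simp [hf, hg]
  | single n z =>
    simp only [raising, toFock, Finsupp.linearCombination_single, map_smul, inner_smul_left]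
    change _ * (_ * inner ℂ _ (toFock v)) = _ * inner ℂ _ (toFock (lowering v))
    simp [inner_fock, toFock_apply, lowering_apply]

theorem inner_toFock_lowering (u v : ℕ →₀ ℂ) :
    inner ℂ (toFock (lowering u)) (toFock v) = inner ℂ (toFock u) (toFock (raising v)) := by
  rw [← inner_conj_symm, ← inner_toFock_raising, inner_conj_symm]

theorem inner_toFock_gen (α : ℂ) (u v : ℕ →₀ ℂ) :
    inner ℂ (toFock (gen α u)) (toFock v) = - inner ℂ (toFock u) (toFock (gen α v)) := by
  simp only [gen, LinearMap.sub_apply, LinearMap.smul_apply, map_sub, map_smul, inner_sub_left,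
    inner_sub_right, inner_smul_left, inner_smul_right, inner_toFock_raising,
    inner_toFock_lowering, Complex.conj_conj]
  ring

theorem inner_toFock_gen_pow (α : ℂ) (j : ℕ) (u v : ℕ →₀ ℂ) :
    inner ℂ (toFock ((gen α ^ j) u)) (toFock v) =
      (-1) ^ j * inner ℂ (toFock u) (toFock ((gen α ^ j) v)) := by
  induction j generalizing u v with
  | zero => simp
  | succ j ih =>
    rw [pow_succ', Module.End.mul_apply, inner_toFock_gen, ih, ← Module.End.mul_apply, ← pow_succ,
      ← pow_succ']
    ring

/-- The factor by which the `k`-th displacement term of `|n⟩` is bounded; the geometric weight `c`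
makes the coefficient at `|i⟩` smaller by a further `c ^ i`. -/
noncomputable def dispBound (c : ℝ) (α : ℂ) (n k : ℕ) : ℝ :=
  ∏ l ∈ Finset.range k, (2 * c * ‖α‖ * Real.sqrt (n + l + 1) / (l + 1))

theorem dispBound_nonneg {c : ℝ} (hc : 0 ≤ c) (α : ℂ) (n k : ℕ) : 0 ≤ dispBound c α n k :=
  Finset.prod_nonneg fun _ _ => by positivity

theorem summable_dispBound (c : ℝ) (α : ℂ) (n : ℕ) : Summable (dispBound c α n) := by
  by_cases h0 : 2 * c * ‖α‖ = 0
  · refine summable_of_ne_finset_zero (s := {0}) fun k hk => ?_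
    obtain ⟨k, rfl⟩ := Nat.exists_eq_succ_of_ne_zero (by simpa using hk)
    simp [dispBound, h0]
  refine summable_of_ratio_test_tendsto_lt_one (l := 0) one_pos ?_ ?_
  · refine Eventually.of_forall fun k => Finset.prod_ne_zero_iff.mpr fun l _ => ?_
    have : Real.sqrt (n + l + 1) ≠ 0 := by positivity
    have : (l : ℝ) + 1 ≠ 0 := by positivity
    positivity
  · have hb : ∀ k : ℕ, ‖dispBound c α n (k + 1)‖ / ‖dispBound c α n k‖ =
        |2 * c * ‖α‖| * (Real.sqrt (n + k + 1) / (k + 1)) := by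
      intro k
      have hne : ‖dispBound c α n k‖ ≠ 0 := by
        refine norm_ne_zero_iff.mpr (Finset.prod_ne_zero_iff.mpr fun l _ => ?_)
        have : Real.sqrt (n + l + 1) ≠ 0 := by positivity
        positivity
      rw [dispBound, Finset.prod_range_succ, ← dispBound, norm_mul, mul_div_cancel_left₀ _ hne,
        Real.norm_eq_abs, mul_div_assoc, abs_mul, abs_of_nonneg (by positivity :
          0 ≤ Real.sqrt (n + k + 1) / ((k : ℝ) + 1))]
    simp_rw [hb]
    rw [show (0 : ℝ) = |2 * c * ‖α‖| * 0 by simp]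
    refine Tendsto.const_mul _ ?_
    have h1 : Tendsto (fun k : ℕ => Real.sqrt ((n + 1) / ((k : ℝ) + 1))) atTop (𝓝 0) := by
      rw [← Real.sqrt_zero]
      refine (Real.continuous_sqrt.tendsto 0).comp ?_
      have := (tendsto_one_div_add_atTop_nhds_zero_nat (𝕜 := ℝ)).const_mul ((n : ℝ) + 1)
      simpa [mul_div_assoc, div_eq_mul_inv] using this
    refine squeeze_zero (fun k => by positivity) (fun k => ?_) h1
    rw [Real.le_sqrt (by positivity) (by positivity), div_pow, Real.sq_sqrt (by positivity),
      div_le_div_iff₀ (by positivity) (by positivity)]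
    have hk : (0 : ℝ) ≤ k := by positivity
    have hn : (0 : ℝ) ≤ n := by positivity
    nlinarith [mul_nonneg hn hk, mul_nonneg (mul_nonneg hn hk) hk, mul_nonneg hk hk]

theorem gen_pow_apply_eq_zero (α : ℂ) (n k i : ℕ) (h : n + k < i) :
    (gen α ^ k) (Finsupp.single n 1) i = 0 := by
  induction k generalizing i with
  | zero => simp [show n ≠ i by omega]
  | succ k ih =>
    rw [pow_succ', Module.End.mul_apply, gen_apply, ih _ (by omega), ih _ (by omega)]
    simp

theorem norm_gen_pow_apply_le {c : ℝ} (hc : 1 ≤ c) (α : ℂ) (n k i : ℕ) :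
    ‖(gen α ^ k) (Finsupp.single n 1) i‖ ≤
      c ^ n / c ^ i * ∏ l ∈ Finset.range k, (2 * c * ‖α‖ * Real.sqrt (n + l + 1)) := by
  have hc0 : 0 < c := by linarith
  induction k generalizing i with
  | zero =>
    by_cases h : n = i
    · subst h; simp [hc0.ne']
    · simp [h]; positivity
  | succ k ih =>
    set B := ∏ l ∈ Finset.range k, (2 * c * ‖α‖ * Real.sqrt (n + l + 1)) with hB
    have hB0 : 0 ≤ B := Finset.prod_nonneg fun _ _ => by positivity
    rw [pow_succ', Module.End.mul_apply, gen_apply, Finset.prod_range_succ, ← hB]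
    set u := (gen α ^ k) (Finsupp.single n 1) with hu
    have h1 : Real.sqrt i * ‖u (i - 1)‖ ≤
        Real.sqrt (n + k + 1) * (c * (c ^ n / c ^ i * B)) := by
      rcases i with _ | i
      · simp; positivity
      · rw [Nat.add_sub_cancel]
        by_cases hi : n + k < i
        · rw [hu, gen_pow_apply_eq_zero α n k i hi]; simp; positivity
        · have hik : ((i + 1 : ℕ) : ℝ) ≤ n + k + 1 := by
            push_cast
            have : (i : ℝ) ≤ ((n + k : ℕ) : ℝ) := by exact_mod_cast not_lt.mp hi
            push_cast at this; linarith
          have he : c * (c ^ n / c ^ (i + 1) * B) = c ^ n / c ^ i * B := by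
            field_simp; ring
          rw [he]
          exact mul_le_mul (Real.sqrt_le_sqrt hik) (ih i) (norm_nonneg _) (Real.sqrt_nonneg _)
    have h2 : Real.sqrt (i + 1) * ‖u (i + 1)‖ ≤
        Real.sqrt (n + k + 1) * (c * (c ^ n / c ^ i * B)) := by
      by_cases hi : n + k < i + 1
      · rw [hu, gen_pow_apply_eq_zero α n k _ hi]; simp; positivity
      · have hik : ((i : ℝ) + 1) ≤ n + k + 1 := by
          have : ((i + 1 : ℕ) : ℝ) ≤ ((n + k : ℕ) : ℝ) := by exact_mod_cast not_lt.mp hi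
          push_cast at this; linarith
        refine mul_le_mul (Real.sqrt_le_sqrt hik) ((ih _).trans ?_) (norm_nonneg _)
          (Real.sqrt_nonneg _)
        have h3 : c ^ n / c ^ (i + 1) * B ≤ c ^ n / c ^ i * B := by
          gcongr
          · omega
        refine h3.trans (le_mul_of_one_le_left (by positivity) hc)
    calc _ ≤ ‖α‖ * (Real.sqrt i * ‖u (i - 1)‖) + ‖α‖ * (Real.sqrt (i + 1) * ‖u (i + 1)‖) := by
          refine (norm_sub_le _ _).trans (le_of_eq ?_)
          simp [abs_of_nonneg, Real.sqrt_nonneg]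
      _ ≤ ‖α‖ * (Real.sqrt (n + k + 1) * (c * (c ^ n / c ^ i * B))) +
          ‖α‖ * (Real.sqrt (n + k + 1) * (c * (c ^ n / c ^ i * B))) := by gcongr
      _ = _ := by ring

theorem displacementTerm_eq (α : ℂ) (n k : ℕ) :
    displacementTerm α n k =
      ((k ! : ℂ)⁻¹) • toFock ((gen α ^ k) (Finsupp.single n 1)) := rfl

theorem displacementTerm_apply (α : ℂ) (n k i : ℕ) :
    displacementTerm α n k i = ((k ! : ℂ)⁻¹) * (gen α ^ k) (Finsupp.single n 1) i := by
  rw [displacementTerm_eq, lp.coeFn_smul, Pi.smul_apply, toFock_apply, smul_eq_mul]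

theorem norm_displacementTerm_apply_le {c : ℝ} (hc : 1 ≤ c) (α : ℂ) (n k i : ℕ) :
    ‖displacementTerm α n k i‖ ≤ c ^ n / c ^ i * dispBound c α n k := by
  have hk : dispBound c α n k =
      (k ! : ℝ)⁻¹ * ∏ l ∈ Finset.range k, (2 * c * ‖α‖ * Real.sqrt (n + l + 1)) := by
    rw [dispBound, Finset.prod_div_distrib, ← Finset.prod_range_add_one_eq_factorial]
    push_cast
    rw [div_eq_inv_mul]
  rw [displacementTerm_apply, norm_mul, hk, mul_left_comm]
  simp only [norm_inv, Complex.norm_natCast]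
  gcongr
  exact norm_gen_pow_apply_le hc α n k i

theorem norm_displacementTerm_le (α : ℂ) (n k : ℕ) :
    ‖displacementTerm α n k‖ ≤ 2 ^ n * 2 * dispBound 2 α n k := by
  have h := lp.hasSum_single (p := 2) (by norm_num) (displacementTerm α n k)
  have hg : HasSum (fun i : ℕ => (2 : ℝ) ^ n * dispBound 2 α n k * (1 / 2) ^ i)
      (2 ^ n * dispBound 2 α n k * 2) := hasSum_geometric_two.mul_left _
  have := tsum_of_norm_bounded (f := fun i => (lp.single 2 i (displacementTerm α n k i) : Fock))
    hg (fun i => ?_)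
  · rw [h.tsum_eq] at this
    linarith
  · rw [lp.norm_single (by norm_num)]
    refine (norm_displacementTerm_apply_le (c := 2) (by norm_num) α n k i).trans (le_of_eq ?_)
    rw [one_div, inv_pow]; ring

theorem summable_norm_displacementTerm (α : ℂ) (n : ℕ) :
    Summable fun k => ‖displacementTerm α n k‖ :=
  .of_nonneg_of_le (fun _ => norm_nonneg _) (norm_displacementTerm_le α n)
    ((summable_dispBound 2 α n).mul_left _)

theorem summable_displacementTerm (α : ℂ) (n : ℕ) : Summable (displacementTerm α n) :=
  (summable_norm_displacementTerm α n).of_norm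

theorem hasSum_displacementTerm (α : ℂ) (n : ℕ) :
    HasSum (displacementTerm α n) (displacedFock α n) :=
  (summable_displacementTerm α n).hasSum

theorem hasSum_displacementTerm_apply (α : ℂ) (n i : ℕ) :
    HasSum (fun k => displacementTerm α n k i) (displacedFock α n i) := by
  simpa [inner_fock] using (hasSum_displacementTerm α n).mapL (innerSL ℂ (fock i))

/-- The coefficients of a displaced Fock state decay faster than any geometric sequence. -/
theorem norm_displacedFock_apply_le {c : ℝ} (hc : 1 ≤ c) (α : ℂ) (n i : ℕ) :
    ‖displacedFock α n i‖ ≤ c ^ n / c ^ i * ∑' k, dispBound c α n k := by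
  rw [← (hasSum_displacementTerm_apply α n i).tsum_eq]
  exact tsum_of_norm_bounded ((summable_dispBound c α n).hasSum.mul_left _)
    (fun k => norm_displacementTerm_apply_le hc α n k i)

/-! ### Displaced Fock states form a Hilbert basis -/

theorem gen_neg (α : ℂ) : gen (-α) = (-1 : ℂ) • gen α := by
  simp only [gen, map_neg]; module

/-- `D(α)† = D(-α)` in matrix elements. -/
theorem displacedFock_apply_conj (α : ℂ) (n i : ℕ) :
    (starRingEnd ℂ) (displacedFock α n i) = displacedFock (-α) i n := by
  have h1 := (hasSum_displacementTerm_apply α n i).map (starRingEnd ℂ) Complex.continuous_conj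
  refine h1.unique ?_
  convert hasSum_displacementTerm_apply (-α) i n using 2 with k
  have h := inner_toFock_gen_pow α k (Finsupp.single n 1) (Finsupp.single i 1)
  rw [toFock_single_one, toFock_single_one, inner_fock_right, inner_fock, toFock_apply,
    toFock_apply] at h
  simp only [Function.comp_apply, displacementTerm_apply, map_mul, h]
  rw [gen_neg, smul_pow, LinearMap.smul_apply, Finsupp.smul_apply, smul_eq_mul]
  simp

theorem inner_displacementTerm (α : ℂ) (m n j k : ℕ) :
    inner ℂ (displacementTerm α m j) (displacementTerm α n k) =
      (j ! : ℂ)⁻¹ * (k ! : ℂ)⁻¹ * (-1) ^ j * (gen α ^ (j + k)) (Finsupp.single n 1) m := by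
  rw [displacementTerm_eq, displacementTerm_eq, inner_smul_left, inner_smul_right,
    inner_toFock_gen_pow, ← Module.End.mul_apply, ← pow_add, toFock_single_one, inner_fock,
    toFock_apply]
  simp; ring

/-- The displacement series of `|m⟩` and `|n⟩` multiply to `∑_L ⟨m|X^L|n⟩ (1 - 1)^L / L!`, as
`X = α a† - α* a` is anti-Hermitian. -/
theorem orthonormal_displacedFock (α : ℂ) : Orthonormal ℂ (displacedFock α) := by
  rw [orthonormal_iff_ite]
  intro m n
  set F : ℕ × ℕ → ℂ := fun p => inner ℂ (displacementTerm α m p.1) (displacementTerm α n p.2)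
    with hF
  have hs : Summable F := by
    refine Summable.of_norm_bounded (g := fun p : ℕ × ℕ =>
      ‖displacementTerm α m p.1‖ * ‖displacementTerm α n p.2‖) ?_ fun p => norm_inner_le_norm _ _
    exact (summable_norm_displacementTerm α m).mul_of_nonneg (summable_norm_displacementTerm α n)
      (fun _ => norm_nonneg _) (fun _ => norm_nonneg _)
  have h1 : HasSum (fun j => inner ℂ (displacementTerm α m j) (displacedFock α n)) (∑' p, F p) :=
    hs.hasSum.prod_fiberwise fun j =>
      (hasSum_displacementTerm α n).mapL (innerSL ℂ (displacementTerm α m j))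
  have h2 : HasSum (fun j => inner ℂ (displacementTerm α m j) (displacedFock α n))
      (inner ℂ (displacedFock α m) (displacedFock α n)) := by
    have := ((hasSum_displacementTerm α m).mapL (innerSL ℂ (displacedFock α n))).map
      (starRingEnd ℂ) Complex.continuous_conj
    simpa [Function.comp_def] using this
  rw [h2.unique h1]
  have h3 := (Finset.HasAntidiagonal.sigmaAntidiagonalEquivProd.hasSum_iff.mpr hs.hasSum).sigma
    (fun L => (hasSum_fintype _))
  refine h3.unique ?_
  have h4 : ∀ L : ℕ, (∑ p : Finset.HasAntidiagonal.antidiagonal L,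
      (F ∘ Finset.HasAntidiagonal.sigmaAntidiagonalEquivProd) ⟨L, p⟩) =
      (L ! : ℂ)⁻¹ * (gen α ^ L) (Finsupp.single n 1) m * 0 ^ L := by
    intro L
    have h5 : (0 : ℂ) ^ L = ((-1) + 1) ^ L := by simp
    rw [h5, (Commute.all (-1 : ℂ) 1).add_pow', Finset.mul_sum]
    simp only [Function.comp_apply, Finset.HasAntidiagonal.sigmaAntidiagonalEquivProd_apply]
    rw [Finset.sum_coe_sort (Finset.HasAntidiagonal.antidiagonal L) F]
    refine Finset.sum_congr rfl fun p hp => ?_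
    obtain ⟨j, k⟩ := p
    obtain rfl : j + k = L := by simpa using hp
    simp only [hF]
    rw [inner_displacementTerm, nsmul_eq_mul, Nat.cast_add_choose]
    have := Nat.factorial_ne_zero (j + k)
    field_simp
    simp
  simp_rw [h4]
  convert hasSum_single 0 fun L hL => ?_ using 1
  · simp [Finsupp.single_apply, eq_comm]
  · simp [hL]

/-- `a D(α) = D(α) (a + α)` in matrix elements. -/
theorem displacedFock_lowering (α : ℂ) (n i : ℕ) :
    ((Real.sqrt (i + 1) : ℝ) : ℂ) * displacedFock α n (i + 1) =
      ((Real.sqrt n : ℝ) : ℂ) * displacedFock α (n - 1) i + α * displacedFock α n i := by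
  have h1 := (hasSum_displacementTerm_apply α n (i + 1)).mul_left ((Real.sqrt (i + 1) : ℝ) : ℂ)
  have h2 := (hasSum_displacementTerm_apply α (n - 1) i).mul_left ((Real.sqrt n : ℝ) : ℂ)
  have h3 := (hasSum_displacementTerm_apply α n i).mul_left α
  have hl : lowering (Finsupp.single n 1) =
      ((Real.sqrt n : ℝ) : ℂ) • Finsupp.single (n - 1) (1 : ℂ) := by
    simp [lowering]
  have h0 : ((Real.sqrt (i + 1) : ℝ) : ℂ) * displacementTerm α n 0 (i + 1) =
      ((Real.sqrt n : ℝ) : ℂ) * displacementTerm α (n - 1) 0 i := by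
    have := lowering_apply (Finsupp.single n 1) i
    rw [hl] at this
    simpa only [displacementTerm_apply, Nat.factorial_zero, Nat.cast_one, inv_one, one_mul,
      pow_zero, Module.End.one_apply, Finsupp.smul_apply, smul_eq_mul] using this.symm
  have hk : ∀ k, ((Real.sqrt (i + 1) : ℝ) : ℂ) * displacementTerm α n (k + 1) (i + 1) =
      ((Real.sqrt n : ℝ) : ℂ) * displacementTerm α (n - 1) (k + 1) i +
        α * displacementTerm α n k i := by
    intro k
    have := DFunLike.congr_fun (LinearMap.congr_fun (lowering_mul_gen_pow α k)
      (Finsupp.single n 1)) i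
    simp only [Module.End.mul_apply, LinearMap.add_apply, LinearMap.smul_apply, hl, map_smul,
      Finsupp.add_apply, Finsupp.smul_apply, smul_eq_mul, lowering_apply] at this
    simp only [displacementTerm_apply]
    rw [mul_left_comm, this, Nat.factorial_succ]
    have h6 : ((k : ℂ) + 1) ≠ 0 := by exact_mod_cast Nat.succ_ne_zero k
    push_cast
    field_simp
  have h4 := (hasSum_nat_add_iff' 1).mpr h1
  have h5 := ((hasSum_nat_add_iff' 1).mpr h2).add h3
  simp only [Finset.range_one, Finset.sum_singleton, hk] at h4 h5
  have := h4.unique h5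
  rw [h0] at this
  linear_combination this

/-- `a† D(α) = D(α) (a† + α*)` in matrix elements. -/
theorem displacedFock_raising (α : ℂ) (n i : ℕ) :
    ((Real.sqrt i : ℝ) : ℂ) * displacedFock α n (i - 1) =
      ((Real.sqrt (n + 1) : ℝ) : ℂ) * displacedFock α (n + 1) i +
        (starRingEnd ℂ) α * displacedFock α n i := by
  have h := congrArg (starRingEnd ℂ) (displacedFock_lowering (-α) i n)
  simp only [map_mul, map_add, displacedFock_apply_conj, Complex.conj_ofReal, neg_neg, map_neg] at h
  linear_combination -h

theorem norm_displacedFock_apply_le' {c : ℝ} (hc : 1 ≤ c) (α : ℂ) (n i : ℕ) :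
    ‖displacedFock α n i‖ ≤ c ^ i / c ^ n * ∑' k, dispBound c (-α) i k := by
  rw [← RCLike.norm_conj, displacedFock_apply_conj]
  exact norm_displacedFock_apply_le hc (-α) i n

theorem norm_displacedFock (α : ℂ) (n : ℕ) : ‖displacedFock α n‖ = 1 :=
  (orthonormal_displacedFock α).1 n

theorem norm_displacedFock_apply_le_one (α : ℂ) (n i : ℕ) : ‖displacedFock α n i‖ ≤ 1 :=
  (lp.norm_apply_le_norm (by norm_num) _ i).trans (norm_displacedFock α n).le

theorem summable_pow_mul_norm_displacedFock (α : ℂ) {q : ℝ} (hq : 0 ≤ q) (i : ℕ) :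
    Summable fun n => q ^ n * ‖displacedFock α n i‖ := by
  -- this weight makes `(q / c) ^ n ≤ (1 / 2) ^ n`
  set c : ℝ := 2 * q + 1 with hc
  have hc0 : 0 < c := by positivity
  refine Summable.of_nonneg_of_le (fun _ => by positivity) (fun n => ?_)
    (summable_geometric_two.mul_right (c ^ i * ∑' k, dispBound c (-α) i k))
  have h0 : 0 ≤ ∑' k, dispBound c (-α) i k := tsum_nonneg fun k => dispBound_nonneg hc0.le _ _ _
  calc q ^ n * ‖displacedFock α n i‖
      ≤ q ^ n * (c ^ i / c ^ n * ∑' k, dispBound c (-α) i k) := by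
        gcongr
        exact norm_displacedFock_apply_le' (by linarith) α n i
    _ = (q / c) ^ n * (c ^ i * ∑' k, dispBound c (-α) i k) := by
        rw [div_pow]; field_simp
    _ ≤ _ := by
        refine mul_le_mul_of_nonneg_right (pow_le_pow_left₀ (by positivity) ?_ n) (by positivity)
        rw [div_le_div_iff₀ hc0 two_pos]; linarith

theorem summable_norm_mul_displacedFock (α : ℂ) (q : ℂ) (i j : ℕ) :
    Summable fun n =>
      ‖q ^ n * (displacedFock α n i * (starRingEnd ℂ) (displacedFock α n j))‖ := by
  refine Summable.of_nonneg_of_le (fun _ => norm_nonneg _) (fun n => ?_)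
    (summable_pow_mul_norm_displacedFock α (norm_nonneg q) i)
  rw [norm_mul, norm_mul, RCLike.norm_conj, norm_pow, ← mul_assoc]
  exact mul_le_of_le_one_right (by positivity) (norm_displacedFock_apply_le_one α n j)

/-- `⟨i| D(α) D(α)† |j⟩ = δ_ij`. -/
theorem hasSum_displacedFock_mul_conj (α : ℂ) (i j : ℕ) :
    HasSum (fun n => displacedFock α n i * (starRingEnd ℂ) (displacedFock α n j))
      (if i = j then 1 else 0) := by
  have h := lp.hasSum_inner (𝕜 := ℂ) (displacedFock (-α) i) (displacedFock (-α) j)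
  rw [orthonormal_iff_ite.mp (orthonormal_displacedFock (-α))] at h
  have e : (fun n => displacedFock α n i * (starRingEnd ℂ) (displacedFock α n j)) =
      fun n => inner ℂ (displacedFock (-α) i n) (displacedFock (-α) j n) := by
    funext n
    rw [RCLike.inner_apply, displacedFock_apply_conj, displacedFock_apply_conj, neg_neg, mul_comm]
  rw [e]
  exact h

theorem hasSum_fock (α : ℂ) (i : ℕ) :
    HasSum (fun n => (starRingEnd ℂ) (displacedFock α n i) • displacedFock α n) (fock i) := by
  have hs : Summable fun n => (starRingEnd ℂ) (displacedFock α n i) • displacedFock α n := by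
    refine Summable.of_norm ?_
    simpa [norm_smul, norm_displacedFock] using
      summable_pow_mul_norm_displacedFock α zero_le_one i
  have : ∑' n, (starRingEnd ℂ) (displacedFock α n i) • displacedFock α n = fock i := by
    ext j
    have h1 := hs.hasSum.mapL (innerSL ℂ (fock j))
    have h2 := hasSum_displacedFock_mul_conj α j i
    simp only [innerSL_apply_apply, inner_smul_right, inner_fock] at h1
    rw [fock_apply, ← h2.tsum_eq, ← h1.tsum_eq]
    exact tsum_congr fun n => mul_comm _ _
  exact this ▸ hs.hasSum

/-- The displaced Fock states, as a Hilbert basis: `D(α)` is unitary. -/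
noncomputable def displacedBasis (α : ℂ) : HilbertBasis ℕ ℂ Fock :=
  HilbertBasis.mkOfOrthogonalEqBot (orthonormal_displacedFock α) (by
    rw [Submodule.eq_bot_iff]
    intro x hx
    ext i
    have h := (hasSum_fock α i).mapL (innerSL ℂ x)
    have h0 : ∀ n, inner ℂ x (displacedFock α n) = 0 := fun n =>
      (Submodule.mem_orthogonal' _ x).mp hx _ (Submodule.subset_span ⟨n, rfl⟩)
    simp only [innerSL_apply_apply, inner_smul_right, inner_fock_right, h0, mul_zero] at h
    simpa using h.unique hasSum_zero)

theorem displacedBasis_apply (α : ℂ) (n : ℕ) : displacedBasis α n = displacedFock α n := by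
  simp [displacedBasis]

/-! ### Matrix elements of displaced geometric weights -/

/-- The matrix element `⟨i| D(α) q^(a†a) D(α)† |j⟩`. -/
noncomputable def geomElem (q : ℝ) (α : ℂ) (i j : ℕ) : ℂ :=
  ∑' n : ℕ, (q : ℂ) ^ n * (displacedFock α n i * (starRingEnd ℂ) (displacedFock α n j))

theorem hasSum_geomElem (q : ℝ) (α : ℂ) (i j : ℕ) :
    HasSum (fun n : ℕ =>
      (q : ℂ) ^ n * (displacedFock α n i * (starRingEnd ℂ) (displacedFock α n j)))
      (geomElem q α i j) :=
  (summable_norm_mul_displacedFock α q i j).of_norm.hasSum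

theorem geomElem_conj (q : ℝ) (α : ℂ) (i j : ℕ) :
    (starRingEnd ℂ) (geomElem q α i j) = geomElem q α j i := by
  refine ((hasSum_geomElem q α i j).map (starRingEnd ℂ) Complex.continuous_conj).unique ?_
  convert hasSum_geomElem q α j i using 2 with n
  simp [mul_comm]

/-- The commutation relations `a D(α) = D(α) (a + α)`, `q^(a†a) a† = q a† q^(a†a)` and
`a† D(α)† = D(α)† (a† - α*)` combine to a recurrence for the matrix elements of
`D(α) q^(a†a) D(α)†`. -/
theorem geomElem_succ (q : ℝ) (α : ℂ) (i j : ℕ) :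
    ((Real.sqrt (i + 1) : ℝ) : ℂ) * geomElem q α (i + 1) j =
      q * (((Real.sqrt j : ℝ) : ℂ) * geomElem q α i (j - 1)) +
        ((1 - q) * α) * geomElem q α i j := by
  have h1 := ((hasSum_geomElem q α (i + 1) j).mul_left ((Real.sqrt (i + 1) : ℝ) : ℂ)).sub
    ((hasSum_geomElem q α i j).mul_left α)
  have h2 := (((hasSum_geomElem q α i (j - 1)).mul_left ((Real.sqrt j : ℝ) : ℂ)).sub
    ((hasSum_geomElem q α i j).mul_left α)).mul_left (q : ℂ)
  have h3 := (hasSum_nat_add_iff' 1).mpr h1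
  have hterm : ∀ n : ℕ, ((Real.sqrt (i + 1) : ℝ) : ℂ) * ((q : ℂ) ^ n *
        (displacedFock α n (i + 1) * (starRingEnd ℂ) (displacedFock α n j))) -
      α * ((q : ℂ) ^ n * (displacedFock α n i * (starRingEnd ℂ) (displacedFock α n j))) =
      (q : ℂ) ^ n * (((Real.sqrt n : ℝ) : ℂ) * displacedFock α (n - 1) i *
        (starRingEnd ℂ) (displacedFock α n j)) := by
    intro n
    linear_combination (q : ℂ) ^ n * (starRingEnd ℂ) (displacedFock α n j) *
      displacedFock_lowering α n i
  have hshift : ∀ n : ℕ, (q : ℂ) ^ (n + 1) * (((Real.sqrt (n + 1 : ℕ) : ℝ) : ℂ) *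
        displacedFock α (n + 1 - 1) i * (starRingEnd ℂ) (displacedFock α (n + 1) j)) =
      q * (((Real.sqrt j : ℝ) : ℂ) * ((q : ℂ) ^ n *
        (displacedFock α n i * (starRingEnd ℂ) (displacedFock α n (j - 1)))) -
      α * ((q : ℂ) ^ n * (displacedFock α n i * (starRingEnd ℂ) (displacedFock α n j)))) := by
    intro n
    have := congrArg (starRingEnd ℂ) (displacedFock_raising α n j)
    simp only [map_mul, map_add, Complex.conj_ofReal, Complex.conj_conj] at this
    rw [Nat.add_sub_cancel]
    push_cast
    linear_combination -(q : ℂ) ^ (n + 1) * displacedFock α n i * this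
  simp only [hterm, hshift, Finset.range_one, Finset.sum_singleton] at h3
  have := h3.unique h2
  simp at this
  linear_combination this

/-- The vacuum coefficients of the displaced Fock states have Poisson weights, up to normalization,
since `a|0⟩ = 0`. -/
theorem norm_sq_displacedFock_zero (α : ℂ) (n : ℕ) :
    displacedFock α n 0 * (starRingEnd ℂ) (displacedFock α n 0) =
      ((‖displacedFock α 0 0‖ ^ 2 * ((‖α‖ ^ 2) ^ n / n !) : ℝ) : ℂ) := by
  rw [Complex.mul_conj, Complex.normSq_eq_norm_sq, Complex.ofReal_inj]
  induction n with
  | zero => simp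
  | succ n ih =>
    have h := displacedFock_raising α n 0
    have h1 : ((Real.sqrt (n + 1) : ℝ) : ℂ) * displacedFock α (n + 1) 0 =
        -((starRingEnd ℂ) α * displacedFock α n 0) := by
      simp at h
      linear_combination -h
    have h2 := congrArg (fun z => ‖z‖ ^ 2) h1
    simp only [norm_mul, norm_neg, mul_pow, RCLike.norm_conj, Complex.norm_real, Real.norm_eq_abs,
      sq_abs, ih] at h2
    rw [Real.sq_sqrt (by positivity)] at h2
    have h3 : (n : ℝ) + 1 ≠ 0 := by positivity
    have h4 : (n ! : ℝ) ≠ 0 := by positivity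
    rw [Nat.factorial_succ]
    push_cast
    field_simp at h2 ⊢
    rw [h2]; ring

/-- Completeness fixes the normalization of the Poisson weights. -/
theorem norm_sq_displacedFock_zero_zero (α : ℂ) :
    ‖displacedFock α 0 0‖ ^ 2 = Real.exp (-‖α‖ ^ 2) := by
  have h1 := hasSum_displacedFock_mul_conj α 0 0
  simp only [norm_sq_displacedFock_zero, if_true] at h1
  have h2 := (NormedSpace.expSeries_div_hasSum_exp (𝔸 := ℝ) (‖α‖ ^ 2)).mul_left
    (‖displacedFock α 0 0‖ ^ 2)
  have h3 := (Complex.hasSum_ofReal.mpr h2).unique h1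
  rw [← Real.exp_eq_exp_ℝ] at h3
  have h4 : ‖displacedFock α 0 0‖ ^ 2 * Real.exp (‖α‖ ^ 2) = 1 := by exact_mod_cast h3
  rw [Real.exp_neg]
  exact eq_inv_of_mul_eq_one_left h4

theorem geomElem_zero_zero (q : ℝ) (α : ℂ) :
    geomElem q α 0 0 = (Real.exp ((q - 1) * ‖α‖ ^ 2) : ℝ) := by
  have h1 := hasSum_geomElem q α 0 0
  have h2 := Complex.hasSum_ofReal.mpr
    ((NormedSpace.expSeries_div_hasSum_exp (𝔸 := ℝ) (q * ‖α‖ ^ 2)).mul_left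
      (‖displacedFock α 0 0‖ ^ 2))
  rw [← Real.exp_eq_exp_ℝ, norm_sq_displacedFock_zero_zero, ← Real.exp_add] at h2
  rw [show (q - 1) * ‖α‖ ^ 2 = -‖α‖ ^ 2 + q * ‖α‖ ^ 2 by ring]
  refine h1.unique ?_
  convert h2 using 2 with n
  rw [norm_sq_displacedFock_zero, norm_sq_displacedFock_zero_zero]
  push_cast
  ring

/-- A Hermitian solution of the recurrence is determined by its vacuum element. -/
theorem eq_of_ladder_recurrence {F G : ℕ → ℕ → ℂ} {q β : ℂ}
    (hF : ∀ i j : ℕ, ((Real.sqrt (i + 1) : ℝ) : ℂ) * F (i + 1) j =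
      q * (((Real.sqrt j : ℝ) : ℂ) * F i (j - 1)) + β * F i j)
    (hG : ∀ i j : ℕ, ((Real.sqrt (i + 1) : ℝ) : ℂ) * G (i + 1) j =
      q * (((Real.sqrt j : ℝ) : ℂ) * G i (j - 1)) + β * G i j)
    (hF' : ∀ i j, (starRingEnd ℂ) (F i j) = F j i) (hG' : ∀ i j, (starRingEnd ℂ) (G i j) = G j i)
    (h0 : F 0 0 = G 0 0) (i j : ℕ) : F i j = G i j := by
  have hne : ∀ i : ℕ, ((Real.sqrt (i + 1) : ℝ) : ℂ) ≠ 0 := fun i => by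
    rw [Complex.ofReal_ne_zero]; positivity
  have hcol : ∀ i, F i 0 = G i 0 := by
    intro i
    induction i with
    | zero => exact h0
    | succ i ih =>
      apply mul_left_cancel₀ (hne i)
      simp [hF, hG, ih]
  induction i generalizing j with
  | zero => rw [← hF', ← hG', hcol]
  | succ i ih =>
    apply mul_left_cancel₀ (hne i)
    rw [hF, hG, ih, ih]

/-- Conjugating the displaced parity operator with `p^(a†a/2)` gives, up to a scalar,
`D(α) (-p)^(a†a) D(α)†`. -/
theorem geomElem_neg {p : ℝ} (hp : 0 < p) (α : ℂ) (i j : ℕ) :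
    geomElem (-p) α i j = (Real.exp (-((p ^ 2 - 1) * ‖α‖ ^ 2 / (2 * p))) : ℝ) *
      ((Real.sqrt p : ℝ) : ℂ) ^ i *
        geomElem (-1) ((((1 + p) / (2 * Real.sqrt p) : ℝ) : ℂ) * α) i j *
          ((Real.sqrt p : ℝ) : ℂ) ^ j := by
  have hs0 : (0 : ℝ) < Real.sqrt p := Real.sqrt_pos.mpr hp
  have hsp : ((Real.sqrt p : ℝ) : ℂ) ≠ 0 := by rw [Complex.ofReal_ne_zero]; exact hs0.ne'
  have hss : ((Real.sqrt p : ℝ) : ℂ) ^ 2 = p := by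
    rw [← Complex.ofReal_pow, Real.sq_sqrt hp.le]
  refine eq_of_ladder_recurrence (F := geomElem (-p) α)
    (G := fun i j => (Real.exp (-((p ^ 2 - 1) * ‖α‖ ^ 2 / (2 * p))) : ℝ) *
      ((Real.sqrt p : ℝ) : ℂ) ^ i *
        geomElem (-1) ((((1 + p) / (2 * Real.sqrt p) : ℝ) : ℂ) * α) i j *
          ((Real.sqrt p : ℝ) : ℂ) ^ j)
    (q := -(p : ℂ)) (β := (1 + p) * α) ?_ ?_ (geomElem_conj _ _) ?_ ?_ i j
  · intro i j
    have := geomElem_succ (-p) α i j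
    push_cast at this ⊢
    rw [this]; ring
  · intro i j
    have := geomElem_succ (-1) ((((1 + p) / (2 * Real.sqrt p) : ℝ) : ℂ) * α) i j
    set γ : ℂ := ((((1 + p) / (2 * Real.sqrt p) : ℝ) : ℂ) * α) with hγ
    have hγ' : 2 * ((Real.sqrt p : ℝ) : ℂ) * γ = (1 + p) * α := by
      rw [hγ]; push_cast; field_simp
    set E : ℂ := ((Real.exp (-((p ^ 2 - 1) * ‖α‖ ^ 2 / (2 * p))) : ℝ) : ℂ)
    set s : ℂ := ((Real.sqrt p : ℝ) : ℂ)
    rw [← hγ', ← hss]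
    rcases j with _ | j
    · simp at this ⊢
      linear_combination E * s ^ (i + 1) * this
    · rw [Nat.add_sub_cancel] at this ⊢
      push_cast at this ⊢
      linear_combination E * s ^ (i + 1) * s ^ (j + 1) * this
  · intro i j
    simp only [map_mul, Complex.conj_ofReal, map_pow, geomElem_conj]
    ring
  · simp only [geomElem_zero_zero, pow_zero, mul_one]
    rw [← Complex.ofReal_mul, Complex.ofReal_inj, ← Real.exp_add]
    congr 1
    rw [norm_mul, Complex.norm_real, mul_pow, Real.norm_eq_abs, sq_abs, div_pow, mul_pow,
      Real.sq_sqrt hp.le]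
    field_simp; ring

/-! ### Operator norms of truncations -/

theorem norm_le_of_forall_sesq {N : ℕ} (B : Matrix (Fin N) (Fin N) ℂ) {C : ℝ} (hC : 0 ≤ C)
    (h : ∀ u v : EuclideanSpace ℂ (Fin N),
      ‖∑ i, ∑ j, (starRingEnd ℂ) (u i) * B i j * v j‖ ≤ C * ‖u‖ * ‖v‖) : ‖B‖ ≤ C := by
  rw [Matrix.cstar_norm_def]
  refine ContinuousLinearMap.opNorm_le_bound _ hC fun v => ?_
  set w := Matrix.toEuclideanCLM (n := Fin N) (𝕜 := ℂ) B v with hw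
  have h1 := h w v
  have h2 : ∑ i, ∑ j, (starRingEnd ℂ) (w i) * B i j * v j = inner ℂ w w := by
    rw [PiLp.inner_apply]
    refine Finset.sum_congr rfl fun i _ => ?_
    have : w i = ∑ j, B i j * v j := by
      rw [hw, Matrix.ofLp_toEuclideanCLM]; rfl
    rw [RCLike.inner_apply]
    nth_rewrite 2 [this]
    rw [Finset.sum_mul]
    exact Finset.sum_congr rfl fun j _ => by ring
  rw [h2, inner_self_eq_norm_sq_to_K] at h1
  simp at h1
  rcases (norm_nonneg w).eq_or_lt with h0 | h0
  · rw [← h0]; positivity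
  · nlinarith

/-- The vector `∑ uᵢ |i⟩` of the Fock space. -/
noncomputable def fockVec {N : ℕ} (u : EuclideanSpace ℂ (Fin N)) : Fock := ∑ i, u i • fock i

theorem orthonormal_fock : Orthonormal ℂ fock := by
  rw [orthonormal_iff_ite]
  intro i j
  rw [inner_fock, fock_apply]

theorem norm_fockVec {N : ℕ} (u : EuclideanSpace ℂ (Fin N)) : ‖fockVec u‖ = ‖u‖ := by
  have ho : Orthonormal ℂ (fun i : Fin N => fock i) :=
    orthonormal_fock.comp _ Fin.val_injective
  have h : (inner ℂ (fockVec u) (fockVec u) : ℂ) = inner ℂ u u := by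
    rw [fockVec, ho.inner_sum, PiLp.inner_apply]
    exact Finset.sum_congr rfl fun i _ => by rw [RCLike.inner_apply, mul_comm]
  rw [inner_self_eq_norm_sq_to_K, inner_self_eq_norm_sq_to_K] at h
  have h' : ‖fockVec u‖ ^ 2 = ‖u‖ ^ 2 := by exact_mod_cast h
  exact (pow_left_inj₀ (norm_nonneg _) (norm_nonneg _) two_ne_zero).mp h'

/-- Contractive weights on an orthonormal family give a contraction: Bessel and Cauchy–Schwarz. -/
theorem norm_geomElem_matrix_le_one {q : ℝ} (hq : |q| ≤ 1) (N : ℕ) (α : ℂ) :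
    ‖(Matrix.of fun i j : Fin N => geomElem q α i j : Matrix (Fin N) (Fin N) ℂ)‖ ≤ 1 := by
  refine norm_le_of_forall_sesq _ zero_le_one fun u v => ?_
  have hs : HasSum (fun n : ℕ => (q : ℂ) ^ n * (inner ℂ (fockVec u) (displacedFock α n) *
      inner ℂ (displacedFock α n) (fockVec v)))
      (∑ i : Fin N, ∑ j : Fin N, (starRingEnd ℂ) (u i) * geomElem q α i j * v j) := by
    have := hasSum_sum (s := Finset.univ) fun (i : Fin N) _ =>
      hasSum_sum (s := Finset.univ) fun (j : Fin N) _ =>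
        ((hasSum_geomElem q α i j).mul_left ((starRingEnd ℂ) (u i))).mul_right (v j)
    refine (congrArg (HasSum · _) (funext fun n => ?_)).mpr this
    simp only [fockVec, sum_inner, inner_sum, inner_smul_left, inner_smul_right, inner_fock,
      inner_fock_right]
    rw [Finset.sum_mul_sum, Finset.mul_sum]
    refine Finset.sum_congr rfl fun i _ => ?_
    rw [Finset.mul_sum]
    exact Finset.sum_congr rfl fun j _ => by ring
  simp only [Matrix.of_apply, one_mul]
  refine le_of_tendsto hs.norm (Eventually.of_forall fun s => ?_)
  have hb : ∀ x : Fock, √(∑ n ∈ s, ‖inner ℂ (displacedFock α n) x‖ ^ 2) ≤ ‖x‖ := fun x =>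
    Real.sqrt_le_iff.mpr ⟨norm_nonneg _, (orthonormal_displacedFock α).sum_inner_products_le x⟩
  calc _ ≤ ∑ n ∈ s, ‖inner ℂ (displacedFock α n) (fockVec u)‖ *
        ‖inner ℂ (displacedFock α n) (fockVec v)‖ := by
        refine (norm_sum_le _ _).trans (Finset.sum_le_sum fun n _ => ?_)
        rw [norm_mul, norm_mul, norm_inner_symm (fockVec u), norm_pow, Complex.norm_real]
        exact mul_le_of_le_one_left (by positivity) (pow_le_one₀ (norm_nonneg _) hq)
    _ ≤ √(∑ n ∈ s, ‖inner ℂ (displacedFock α n) (fockVec u)‖ ^ 2) *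
        √(∑ n ∈ s, ‖inner ℂ (displacedFock α n) (fockVec v)‖ ^ 2) :=
        Real.sum_mul_le_sqrt_mul_sqrt _ _ _
    _ ≤ ‖fockVec u‖ * ‖fockVec v‖ := by gcongr <;> exact hb _
    _ = _ := by rw [norm_fockVec, norm_fockVec]

/-- For growing weights `(-p)^n`, `p ≥ 1`, the truncation to `N` levels has norm at most
`p^(N-1)`, whatever the displacement. -/
theorem norm_geomElem_neg_matrix_le {p : ℝ} (hp : 1 ≤ p) (N : ℕ) (α : ℂ) :
    ‖(Matrix.of fun i j : Fin N => geomElem (-p) α i j : Matrix (Fin N) (Fin N) ℂ)‖ ≤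
      p ^ (N - 1) := by
  have hp0 : 0 < p := by linarith
  set γ : ℂ := (((1 + p) / (2 * Real.sqrt p) : ℝ) : ℂ) * α
  set E : ℝ := Real.exp (-((p ^ 2 - 1) * ‖α‖ ^ 2 / (2 * p)))
  set Dg : Matrix (Fin N) (Fin N) ℂ :=
    Matrix.diagonal fun i : Fin N => ((Real.sqrt p : ℝ) : ℂ) ^ (i : ℕ)
  have hE : E ≤ 1 := Real.exp_le_one_iff.mpr (neg_nonpos.mpr
    (div_nonneg (mul_nonneg (by nlinarith) (by positivity)) (by positivity)))
  have hD : ‖Dg‖ ≤ Real.sqrt p ^ (N - 1) := by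
    rw [Matrix.l2_opNorm_diagonal, pi_norm_le_iff_of_nonneg (by positivity)]
    intro i
    rw [norm_pow, Complex.norm_real, Real.norm_eq_abs, abs_of_nonneg (Real.sqrt_nonneg p)]
    exact pow_le_pow_right₀ (Real.one_le_sqrt.mpr hp) (by omega)
  have he : (Matrix.of fun i j : Fin N => geomElem (-p) α i j : Matrix (Fin N) (Fin N) ℂ) =
      (E : ℂ) • (Dg * (Matrix.of fun i j : Fin N => geomElem (-1) γ i j) * Dg) := by
    ext i j
    simp only [Matrix.of_apply, Matrix.smul_apply, Dg, Matrix.mul_diagonal, Matrix.diagonal_mul,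
      smul_eq_mul]
    rw [geomElem_neg hp0]; ring
  rw [he, norm_smul, Complex.norm_real, Real.norm_eq_abs, abs_of_nonneg (Real.exp_nonneg _)]
  have h1 := norm_geomElem_matrix_le_one (q := -1) (by simp) N γ
  calc _ ≤ 1 * (‖Dg‖ * 1 * ‖Dg‖) := by
        gcongr
        refine (norm_mul_le _ _).trans ?_
        gcongr
        refine (norm_mul_le _ _).trans ?_
        gcongr
    _ ≤ 1 * (Real.sqrt p ^ (N - 1) * 1 * Real.sqrt p ^ (N - 1)) := by gcongr
    _ = p ^ (N - 1) := by rw [one_mul, mul_one, ← mul_pow, Real.mul_self_sqrt hp0.le]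

/-! ### Norms of the truncated operators and of the snapshots -/

theorem eig_eq (r : ℝ) (n : ℕ) :
    eig r n = 2 / (Real.pi * (1 + r)) * (-((1 - r) / (1 + r))) ^ n := by
  rw [eig, neg_pow ((1 - r) / (1 + r)), div_pow, mul_div_assoc', div_mul_div_comm, mul_assoc]

theorem tTerm_eq (r : ℝ) (α : ℂ) (i j n : ℕ) :
    tTerm r α i j n = ((2 / (Real.pi * (1 + r)) : ℝ) : ℂ) *
      (((-((1 - r) / (1 + r)) : ℝ) : ℂ) ^ n *
        (displacedFock α n i * (starRingEnd ℂ) (displacedFock α n j))) := by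
  rw [tTerm, eig_eq, inner_fock, inner_fock_right]; push_cast; ring

theorem summable_tTerm (r : ℝ) (α : ℂ) (i j : ℕ) : Summable (tTerm r α i j) := by
  simp_rw [funext (tTerm_eq r α i j)]
  exact (hasSum_geomElem _ α i j).summable.mul_left _

theorem tMatrix_eq (r : ℝ) (N : ℕ) (α : ℂ) :
    tMatrix r N α = (2 / (Real.pi * (1 + r))) •
      (Matrix.of fun i j : Fin N => geomElem (-((1 - r) / (1 + r))) α i j) := by
  ext i j
  simp only [tMatrix, Matrix.of_apply, Matrix.smul_apply, Complex.real_smul, tTerm_eq]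
  exact ((hasSum_geomElem _ α i j).mul_left _).tsum_eq

/-- The ratio `(1 + |r|) / (1 - |r|)`; its square is the factor by which the sample size grows with
each further photon level. -/
noncomputable def growth (r : ℝ) : ℝ := (1 + |r|) / (1 - |r|)

theorem one_le_growth {r : ℝ} (hr : |r| < 1) : 1 ≤ growth r := by
  rw [growth, one_le_div (by linarith)]
  linarith [abs_nonneg r]

/-- A bound for all snapshots; it is smaller by the factor `growth r` than the product of the
eigenvalue bounds. -/
noncomputable def snapBound (A r : ℝ) (N : ℕ) : ℝ :=
  A * (4 / (Real.pi ^ 2 * (1 - r ^ 2)) * growth r ^ (N - 1))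

theorem snapBound_nonneg {A r : ℝ} (hA : 0 ≤ A) (hr : |r| < 1) (N : ℕ) : 0 ≤ snapBound A r N := by
  have h1 := one_le_growth hr
  have h2 : r ^ 2 < 1 := (sq_lt_one_iff_abs_lt_one r).mpr hr
  have : 0 < 1 - r ^ 2 := by linarith
  unfold snapBound; positivity

theorem norm_snapshot_le {A r : ℝ} (hA : 0 ≤ A) (hr : |r| < 1) {N : ℕ} {M : ℕ∞}
    (hM : M = N ∨ (r = 0 ∧ M = ⊤)) (x : ℕ × ℂ) : ‖snapshot A r N M x‖ ≤ snapBound A r N := by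
  unfold snapshot
  split_ifs with hx
  swap
  · simpa using snapBound_nonneg hA hr N
  obtain ⟨hr1, hr2⟩ := abs_lt.mp hr
  have hp := one_le_growth hr
  have hpos1 : 0 < 1 + r := by linarith
  have hpos2 : 0 < 1 - r := by linarith
  have hmain : |(-((1 - r) / (1 + r))) ^ x.1| *
      ‖(Matrix.of fun i j : Fin N => geomElem (-((1 + r) / (1 - r))) x.2 i j :
        Matrix (Fin N) (Fin N) ℂ)‖ ≤ growth r ^ (N - 1) := by
    rw [abs_pow, abs_neg, abs_of_pos (by positivity)]
    rcases le_or_gt 0 r with h0 | h0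
    · have hg : growth r = (1 + r) / (1 - r) := by rw [growth, abs_of_nonneg h0]
      have h1 := norm_geomElem_neg_matrix_le hp N x.2
      rw [hg] at h1 ⊢
      refine (mul_le_of_le_one_left (norm_nonneg _) (pow_le_one₀ (by positivity) ?_)).trans h1
      rw [div_le_one hpos1]; linarith
    · have hg : growth r = (1 - r) / (1 + r) := by
        rw [growth, abs_of_neg h0]; simp [sub_eq_add_neg]
      have h1 := norm_geomElem_matrix_le_one (q := -((1 + r) / (1 - r))) (by
        rw [abs_neg, abs_of_pos (by positivity), div_le_one hpos2]; linarith) N x.2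
      refine (mul_le_of_le_one_right (by positivity) h1).trans ?_
      rw [hg] at hp ⊢
      rcases hM with rfl | ⟨rfl, -⟩
      · exact pow_le_pow_right₀ hp (Nat.le_sub_one_of_lt (by exact_mod_cast hx))
      · simp at h0
  rw [norm_smul, dualMatrix, tMatrix_eq, norm_smul, eig_eq, sub_neg_eq_add, ← sub_eq_add_neg]
  simp only [Real.norm_eq_abs]
  rw [abs_mul, abs_mul, abs_of_nonneg hA, abs_of_nonneg (a := 2 / (Real.pi * (1 + r)))
    (by positivity), abs_of_nonneg (a := 2 / (Real.pi * (1 - r))) (by positivity), snapBound]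
  have h4 : 4 / (Real.pi ^ 2 * (1 - r ^ 2)) =
      2 / (Real.pi * (1 + r)) * (2 / (Real.pi * (1 - r))) := by
    rw [div_mul_div_comm]; congr 1 <;> ring
  rw [h4]
  calc _ = A * (2 / (Real.pi * (1 + r)) * (2 / (Real.pi * (1 - r)))) *
        (|(-((1 - r) / (1 + r))) ^ x.1| *
      ‖(Matrix.of fun i j : Fin N => geomElem (-((1 + r) / (1 - r))) x.2 i j :
        Matrix (Fin N) (Fin N) ℂ)‖) := by ring
    _ ≤ A * (2 / (Real.pi * (1 + r)) * (2 / (Real.pi * (1 - r)))) * growth r ^ (N - 1) := by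
        gcongr
    _ = _ := by ring

/-! ### Density operators -/

theorem hasSum_norm_sq_inner {E : Type*} [NormedAddCommGroup E] [InnerProductSpace ℂ E]
    (b : HilbertBasis ℕ ℂ E) (x : E) :
    HasSum (fun n => ‖inner ℂ (b n) x‖ ^ 2) (‖x‖ ^ 2) := by
  have h := b.hasSum_inner_mul_inner x x
  rw [inner_self_eq_norm_sq_to_K] at h
  have h2 : HasSum (fun n => ((‖inner ℂ (b n) x‖ ^ 2 : ℝ) : ℂ)) ((‖x‖ ^ 2 : ℝ) : ℂ) := by
    push_cast
    refine (congrArg (HasSum · _) (funext fun n => ?_)).mpr h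
    rw [← inner_conj_symm x (b n), mul_comm, Complex.mul_conj, Complex.normSq_eq_norm_sq]
    push_cast; rfl
  exact Complex.hasSum_ofReal.mp h2

/-- The Hilbert–Schmidt norm of an operator does not depend on the basis, and agrees with that of
its adjoint. -/
theorem tsum_norm_sq_apply {E : Type*} [NormedAddCommGroup E] [InnerProductSpace ℂ E]
    [CompleteSpace E] (b e : HilbertBasis ℕ ℂ E) (S : E →L[ℂ] E) :
    ∑' n, ENNReal.ofReal (‖S (b n)‖ ^ 2) =
      ∑' k, ENNReal.ofReal (‖ContinuousLinearMap.adjoint S (e k)‖ ^ 2) := by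
  have h1 : ∀ (f : HilbertBasis ℕ ℂ E) (x : E),
      ENNReal.ofReal (‖x‖ ^ 2) = ∑' k, ENNReal.ofReal (‖inner ℂ (f k) x‖ ^ 2) := fun f x => by
    rw [← (hasSum_norm_sq_inner f x).tsum_eq,
      ENNReal.ofReal_tsum_of_nonneg (fun _ => by positivity) (hasSum_norm_sq_inner f x).summable]
  simp_rw [fun n => h1 e (S (b n)), fun k => h1 b (ContinuousLinearMap.adjoint S (e k))]
  rw [ENNReal.tsum_comm]
  refine tsum_congr fun k => tsum_congr fun n => ?_
  rw [ContinuousLinearMap.adjoint_inner_right, norm_inner_symm]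

/-- The Fock states, as a Hilbert basis. -/
noncomputable def fockBasis : HilbertBasis ℕ ℂ Fock :=
  HilbertBasis.mkOfOrthogonalEqBot orthonormal_fock (by
    rw [Submodule.eq_bot_iff]
    intro x hx
    ext i
    rw [← inner_fock]
    exact (Submodule.mem_orthogonal _ x).mp hx _ (Submodule.subset_span ⟨i, rfl⟩))

theorem fockBasis_apply (n : ℕ) : fockBasis n = fock n := by
  simp [fockBasis]

theorem exists_eq_adjoint_mul_self {E : Type*} [NormedAddCommGroup E] [InnerProductSpace ℂ E]
    [CompleteSpace E] {f : E →L[ℂ] E} (h : f.IsPositive) : ∃ S : E →L[ℂ] E, f = star S * S :=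
  CStarAlgebra.nonneg_iff_eq_star_mul_self.mp ((ContinuousLinearMap.nonneg_iff_isPositive f).mpr h)

theorem IsDensityOperator.exists_factor {ρ : Fock →L[ℂ] Fock} (h : IsDensityOperator ρ) :
    ∃ S : Fock →L[ℂ] Fock, (∀ x y, inner ℂ x (ρ y) = inner ℂ (S x) (S y)) ∧
      HasSum (fun n => ‖S (fock n)‖ ^ 2) 1 := by
  obtain ⟨S, hS⟩ := exists_eq_adjoint_mul_self h.isPositive
  have hi : ∀ x y, inner ℂ x (ρ y) = inner ℂ (S x) (S y) := fun x y => by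
    rw [hS, ContinuousLinearMap.star_eq_adjoint, mul_apply_eq_comp,
      ContinuousLinearMap.adjoint_inner_right]
  refine ⟨S, hi, ?_⟩
  have ht := h.trace_eq_one
  refine (congrArg (HasSum · _) (funext fun n => ?_)).mpr ht
  rw [hi]
  exact (inner_self_eq_norm_sq (𝕜 := ℂ) (S (fock n))).symm

theorem photonProb_nonneg {ρ : Fock →L[ℂ] Fock} (h : IsDensityOperator ρ) (n : ℕ) (α : ℂ) :
    0 ≤ photonProb ρ n α := by
  obtain ⟨S, hS, -⟩ := h.exists_factor
  rw [photonProb, hS]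
  exact inner_self_nonneg (𝕜 := ℂ)

/-- The photon statistics after a displacement is a probability distribution, as the trace of `ρ`
can be computed in the basis of displaced Fock states. -/
theorem tsum_ofReal_photonProb {ρ : Fock →L[ℂ] Fock} (h : IsDensityOperator ρ) (α : ℂ) :
    ∑' n, ENNReal.ofReal (photonProb ρ n α) = 1 := by
  obtain ⟨S, hS, hs⟩ := h.exists_factor
  have h1 : ∀ n, photonProb ρ n α = ‖S (displacedBasis α n)‖ ^ 2 := fun n => by
    rw [photonProb, hS, displacedBasis_apply]
    exact inner_self_eq_norm_sq (𝕜 := ℂ) _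
  simp_rw [h1]
  rw [tsum_norm_sq_apply _ fockBasis, ← tsum_norm_sq_apply fockBasis fockBasis]
  simp_rw [fockBasis_apply]
  rw [← ENNReal.ofReal_tsum_of_nonneg (fun _ => by positivity) hs.summable, hs.tsum_eq,
    ENNReal.ofReal_one]

theorem summable_photonProb {ρ : Fock →L[ℂ] Fock} (h : IsDensityOperator ρ) (α : ℂ) :
    Summable fun n => photonProb ρ n α := by
  have h1 := ENNReal.summable_toReal (f := fun n => ENNReal.ofReal (photonProb ρ n α))
    (by rw [tsum_ofReal_photonProb h]; exact ENNReal.one_ne_top)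
  simpa [ENNReal.toReal_ofReal (photonProb_nonneg h _ α)] using h1

theorem norm_truncState_le_one {ρ : Fock →L[ℂ] Fock} (h : IsDensityOperator ρ) (N : ℕ) :
    ‖truncState N ρ‖ ≤ 1 := by
  obtain ⟨S, hS, hs⟩ := h.exists_factor
  have hb : ∀ u : EuclideanSpace ℂ (Fin N), ‖S (fockVec u)‖ ≤ ‖u‖ := fun u => by
    have h1 : ∑ i : Fin N, ‖S (fock i)‖ ^ 2 ≤ 1 := by
      rw [Fin.sum_univ_eq_sum_range (fun i => ‖S (fock i)‖ ^ 2)]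
      exact sum_le_hasSum _ (fun _ _ => by positivity) hs
    calc ‖S (fockVec u)‖ ≤ ∑ i : Fin N, ‖u i‖ * ‖S (fock i)‖ := by
          rw [fockVec, map_sum]
          refine (norm_sum_le _ _).trans (Finset.sum_le_sum fun i _ => ?_)
          rw [map_smul, norm_smul]
      _ ≤ √(∑ i : Fin N, ‖u i‖ ^ 2) * √(∑ i : Fin N, ‖S (fock i)‖ ^ 2) :=
          Real.sum_mul_le_sqrt_mul_sqrt _ _ _
      _ ≤ ‖u‖ * 1 := by
          rw [← EuclideanSpace.norm_eq]
          gcongr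
          exact Real.sqrt_le_one.mpr h1
      _ = ‖u‖ := mul_one _
  refine norm_le_of_forall_sesq _ zero_le_one fun u v => ?_
  have : ∑ i, ∑ j, (starRingEnd ℂ) (u i) * truncState N ρ i j * v j =
      inner ℂ (S (fockVec u)) (S (fockVec v)) := by
    rw [← hS]
    simp only [fockVec, map_sum, map_smul, sum_inner, inner_sum, inner_smul_left,
      inner_smul_right, truncState, Matrix.of_apply]
    rw [Finset.sum_comm]
    refine Finset.sum_congr rfl fun j _ => ?_
    rw [Finset.mul_sum]
    exact Finset.sum_congr rfl fun i _ => by ring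
  rw [this, one_mul]
  exact (norm_inner_le_norm _ _).trans (mul_le_mul (hb u) (hb v) (norm_nonneg _) (norm_nonneg _))

/-! ### A Bernstein inequality in Hilbert space -/

/-- `cosh ∘ √` is convex on `[0, ∞)`, since its power series has nonnegative coefficients. -/
theorem cosh_le_of_sq_eq {x y z t : ℝ} (ht0 : 0 ≤ t) (ht1 : t ≤ 1)
    (h : x ^ 2 = (1 - t) * y ^ 2 + t * z ^ 2) :
    Real.cosh x ≤ (1 - t) * Real.cosh y + t * Real.cosh z := by
  refine hasSum_le (fun k => ?_) (Real.hasSum_cosh x)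
    (((Real.hasSum_cosh y).mul_left (1 - t)).add ((Real.hasSum_cosh z).mul_left t))
  have h1 := (convexOn_pow k).2 (Set.mem_Ici.mpr (sq_nonneg y)) (Set.mem_Ici.mpr (sq_nonneg z))
    (sub_nonneg.mpr ht1) ht0 (by ring)
  simp only [smul_eq_mul] at h1
  rw [← h] at h1
  rw [pow_mul, pow_mul, pow_mul, mul_div_assoc', mul_div_assoc', ← add_div]
  gcongr

/-- One step of the exponential moment estimate for a random walk in a real inner product space. By
convexity in the angle between `s` and `x` it suffices to check the two collinear cases. At
`s = 0` the linear term is zero, so the value of `sinh ‖s‖ / ‖s‖` there does not matter. -/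
theorem cosh_norm_add_le {H : Type*} [NormedAddCommGroup H] [InnerProductSpace ℝ H] (s x : H) :
    Real.cosh ‖s + x‖ ≤ Real.cosh ‖s‖ + Real.sinh ‖s‖ / ‖s‖ * inner ℝ s x +
      Real.cosh ‖s‖ * (Real.exp ‖x‖ - 1 - ‖x‖) := by
  set a := ‖s‖ with ha
  set b := ‖x‖ with hb
  set c := (inner ℝ s x : ℝ) with hc
  have ha0 : 0 ≤ a := norm_nonneg _
  have hb0 : 0 ≤ b := norm_nonneg _
  have hn : ‖s + x‖ ^ 2 = a ^ 2 + 2 * c + b ^ 2 := norm_add_sq_real s x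
  have hcab : |c| ≤ a * b := abs_real_inner_le_norm s x
  obtain ⟨hc1, hc2⟩ := abs_le.mp hcab
  have hbs := sub_nonneg.mpr (Real.self_le_sinh_iff.mpr hb0)
  have hcs : Real.sinh a ≤ Real.cosh a := (Real.sinh_lt_cosh a).le
  have hs0 : 0 ≤ Real.sinh a := Real.sinh_nonneg_iff.mpr ha0
  have hexp : Real.exp b = Real.cosh b + Real.sinh b := (Real.cosh_add_sinh b).symm
  rcases eq_or_ne (a * b) 0 with h0 | h0
  · have hc0 : c = 0 := abs_nonpos_iff.mp (hcab.trans h0.le)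
    rcases mul_eq_zero.mp h0 with h | h
    · rw [hc0, h] at hn
      have : ‖s + x‖ = b := by
        refine (pow_left_inj₀ (norm_nonneg _) hb0 two_ne_zero).mp ?_
        linarith
      rw [this, hc0, h, hexp, Real.cosh_zero]; linarith
    · rw [hc0, h] at hn
      have : ‖s + x‖ = a := by
        refine (pow_left_inj₀ (norm_nonneg _) ha0 two_ne_zero).mp ?_
        linarith
      rw [this, hc0, h]; simp
  · have hab : 0 < a * b := lt_of_le_of_ne (by positivity) h0.symm
    have hapos : 0 < a := lt_of_le_of_ne ha0 (by rintro h; simp [← h] at h0)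
    have hb1 : b ≠ 0 := right_ne_zero_of_mul h0
    set t : ℝ := (c + a * b) / (2 * (a * b)) with ht
    have ht0 : 0 ≤ t := div_nonneg (by linarith) (by positivity)
    have ht1 : t ≤ 1 := by rw [ht, div_le_one (by positivity)]; linarith
    have hct : c = (2 * t - 1) * (a * b) := by rw [ht]; field_simp; ring
    have h1 := cosh_le_of_sq_eq (x := ‖s + x‖) (y := a - b) (z := a + b) ht0 ht1
      (by rw [hn, hct]; ring)
    have h2 : Real.cosh (a - b) ≤ Real.cosh a - Real.sinh a * b +
        Real.cosh a * (Real.exp b - 1 - b) := by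
      rw [Real.cosh_sub, hexp]
      nlinarith [mul_nonneg hs0 hbs, mul_nonneg (Real.cosh_pos a).le hbs]
    have h3 : Real.cosh (a + b) ≤ Real.cosh a + Real.sinh a * b +
        Real.cosh a * (Real.exp b - 1 - b) := by
      rw [Real.cosh_add, hexp]
      nlinarith [mul_nonneg (sub_nonneg.mpr hcs) hbs]
    have h4 : Real.sinh a / a * c = (2 * t - 1) * (Real.sinh a * b) := by
      rw [hct]; field_simp
    rw [h4]
    nlinarith [mul_le_mul_of_nonneg_left h2 (sub_nonneg.mpr ht1),
      mul_le_mul_of_nonneg_left h3 ht0]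

theorem exp_sub_one_sub_le {x y : ℝ} (hx : 0 ≤ x) (hxy : x ≤ y) (hy : y < 2) :
    Real.exp x - 1 - x ≤ x ^ 2 / 2 / (1 - y / 2) := by
  have hy0 : 0 ≤ y := hx.trans hxy
  have h1 := (hasSum_nat_add_iff' 2).mpr (NormedSpace.expSeries_div_hasSum_exp (𝔸 := ℝ) x)
  rw [← Real.exp_eq_exp_ℝ] at h1
  have h2 := (hasSum_geometric_of_lt_one (r := y / 2) (by linarith) (by linarith)).mul_left
    (x ^ 2 / 2)
  have h3 := hasSum_le (fun k => ?_) h1 h2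
  · simp [Finset.sum_range_succ] at h3
    rw [div_eq_mul_inv _ (1 - y / 2)]; linarith
  -- compare the exponential series with a geometric one, as `2 * 2 ^ k ≤ (k + 2)!`
  · have hf : (2 : ℝ) * 2 ^ k ≤ ((k + 2) ! : ℕ) := by
      have : 2 * 2 ^ k ≤ (k + 2) ! := by
        induction k with
        | zero => simp [Nat.factorial]
        | succ k ih =>
          rw [Nat.factorial_succ (k + 2), pow_succ]
          nlinarith
      exact_mod_cast this
    rw [div_pow, div_mul_div_comm, pow_add, mul_comm (x ^ k)]
    gcongr

theorem integral_cosh_norm_add_le {Ω H : Type*} [MeasurableSpace Ω] [NormedAddCommGroup H]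
    [InnerProductSpace ℝ H] [CompleteSpace H]
    {μ : Measure Ω} [IsProbabilityMeasure μ]
    {X : Ω → H} (hX : StronglyMeasurable X) {B m : ℝ} (hB : ∀ ω, ‖X ω‖ ≤ B) (h0 : ∫ ω, X ω ∂μ = 0)
    (hm : ∫ ω, (Real.exp ‖X ω‖ - 1 - ‖X ω‖) ∂μ ≤ m) (s : H) :
    ∫ ω, Real.cosh ‖s + X ω‖ ∂μ ≤ (1 + m) * Real.cosh ‖s‖ := by
  have hXi : Integrable X μ := .of_bound hX.aestronglyMeasurable B (.of_forall hB)
  have hi1 : Integrable (fun ω => inner ℝ s (X ω)) μ := hXi.const_inner s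
  have hi2 : Integrable (fun ω => Real.exp ‖X ω‖) μ := by
    refine .of_bound (Real.continuous_exp.comp_stronglyMeasurable
      hX.norm).aestronglyMeasurable (Real.exp B) (.of_forall fun ω => ?_)
    simpa using hB ω
  have hi3 : Integrable (fun ω => Real.exp ‖X ω‖ - 1 - ‖X ω‖) μ :=
    (hi2.sub (integrable_const 1)).sub hXi.norm
  have hz : ∫ ω, inner ℝ s (X ω) ∂μ = 0 := by
    rw [integral_inner hXi, h0, inner_zero_right]
  calc ∫ ω, Real.cosh ‖s + X ω‖ ∂μ
      ≤ ∫ ω, (Real.cosh ‖s‖ + Real.sinh ‖s‖ / ‖s‖ * inner ℝ s (X ω) +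
          Real.cosh ‖s‖ * (Real.exp ‖X ω‖ - 1 - ‖X ω‖)) ∂μ := by
        refine integral_mono_of_nonneg (.of_forall fun ω => (Real.cosh_pos _).le)
          (((integrable_const _).add (hi1.const_mul _)).add (hi3.const_mul _))
          (.of_forall fun ω => cosh_norm_add_le s (X ω))
    _ = Real.cosh ‖s‖ + Real.cosh ‖s‖ * ∫ ω, (Real.exp ‖X ω‖ - 1 - ‖X ω‖) ∂μ := by
        have hi4 : Integrable (fun ω => Real.cosh ‖s‖ + Real.sinh ‖s‖ / ‖s‖ * inner ℝ s (X ω)) μ :=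
          (integrable_const _).add (hi1.const_mul _)
        rw [integral_add hi4 (hi3.const_mul _), integral_add (integrable_const _) (hi1.const_mul _),
          integral_const_mul,
          integral_const_mul, hz]
        simp
    _ ≤ Real.cosh ‖s‖ + Real.cosh ‖s‖ * m := by
        gcongr
    _ = _ := by ring

theorem stronglyMeasurable_sum_pi {Ω H : Type*} [MeasurableSpace Ω] [NormedAddCommGroup H]
    {X : Ω → H} (hX : StronglyMeasurable X) (T : ℕ) :
    StronglyMeasurable fun x : Fin T → Ω => ∑ i, X (x i) :=
  Finset.stronglyMeasurable_fun_sum _ fun i _ => hX.comp_measurable (measurable_pi_apply i)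

theorem integral_cosh_norm_sum_le {Ω H : Type*} [MeasurableSpace Ω] [NormedAddCommGroup H]
    [InnerProductSpace ℝ H] [CompleteSpace H]
    {μ : Measure Ω} [IsProbabilityMeasure μ]
    {X : Ω → H} (hX : StronglyMeasurable X) {B m : ℝ} (hB : ∀ ω, ‖X ω‖ ≤ B) (h0 : ∫ ω, X ω ∂μ = 0)
    (hm : ∫ ω, (Real.exp ‖X ω‖ - 1 - ‖X ω‖) ∂μ ≤ m) (hm0 : 0 ≤ m) (T : ℕ) (s : H) :
    ∫ x, Real.cosh ‖s + ∑ i, X (x i)‖ ∂(Measure.pi fun _ : Fin T => μ) ≤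
      (1 + m) ^ T * Real.cosh ‖s‖ := by
  have hint : ∀ (T : ℕ) (s : H), Integrable (fun x : Fin T → Ω => Real.cosh ‖s + ∑ i, X (x i)‖)
      (Measure.pi fun _ : Fin T => μ) := fun T s => by
    refine .of_bound (Real.continuous_cosh.comp_stronglyMeasurable
      ((stronglyMeasurable_const.add (stronglyMeasurable_sum_pi hX T)).norm)).aestronglyMeasurable
      (Real.cosh (‖s‖ + T * B)) (.of_forall fun x => ?_)
    rw [Real.norm_eq_abs, abs_of_pos (Real.cosh_pos _), Real.cosh_le_cosh, abs_norm]
    refine le_trans ?_ (le_abs_self _)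
    refine (norm_add_le _ _).trans ?_
    gcongr
    refine (norm_sum_le_of_le _ fun i _ => hB (x i)).trans ?_
    simp
  induction T generalizing s with
  | zero => simp
  | succ T ih =>
    have hmp := measurePreserving_piFinSuccAbove (fun _ : Fin (T + 1) => μ) 0
    have he : ∀ x : Fin (T + 1) → Ω, Real.cosh ‖s + ∑ i, X (x i)‖ =
        (fun y : Ω × (Fin T → Ω) => Real.cosh ‖(s + X y.1) + ∑ i, X (y.2 i)‖)
          (MeasurableEquiv.piFinSuccAbove (fun _ => Ω) 0 x) := by
      intro x
      simp [Fin.sum_univ_succ, add_assoc, MeasurableEquiv.piFinSuccAbove, Fin.insertNthEquiv]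
      rfl
    have hsm : StronglyMeasurable
        (fun y : Ω × (Fin T → Ω) => Real.cosh ‖(s + X y.1) + ∑ i, X (y.2 i)‖) :=
      Real.continuous_cosh.comp_stronglyMeasurable (((stronglyMeasurable_const.add
        (hX.comp_measurable measurable_fst)).add
          ((stronglyMeasurable_sum_pi hX T).comp_measurable measurable_snd)).norm)
    have hi : Integrable (fun y : Ω × (Fin T → Ω) => Real.cosh ‖(s + X y.1) + ∑ i, X (y.2 i)‖)
        (μ.prod (Measure.pi fun _ : Fin T => μ)) := by
      rw [← hmp.integrable_comp_emb (MeasurableEquiv.measurableEmbedding _)]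
      exact (hint (T + 1) s).congr (.of_forall he)
    rw [integral_congr_ae (.of_forall he), hmp.integral_comp' (f := MeasurableEquiv.piFinSuccAbove
      (fun _ => Ω) 0) (fun y : Ω × (Fin T → Ω) => Real.cosh ‖(s + X y.1) + ∑ i, X (y.2 i)‖),
      integral_prod _ hi]
    have hs1 : Integrable (fun ω => Real.cosh ‖s + X ω‖) μ := by
      refine .of_bound (Real.continuous_cosh.comp_stronglyMeasurable
        ((stronglyMeasurable_const.add hX).norm)).aestronglyMeasurable
        (Real.cosh (‖s‖ + B)) (.of_forall fun x => ?_)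
      rw [Real.norm_eq_abs, abs_of_pos (Real.cosh_pos _), Real.cosh_le_cosh, abs_norm]
      refine le_trans ?_ (le_abs_self _)
      exact (norm_add_le _ _).trans (by gcongr; exact hB x)
    calc _ ≤ ∫ ω, (1 + m) ^ T * Real.cosh ‖s + X ω‖ ∂μ :=
          integral_mono hi.integral_prod_left (hs1.const_mul _) fun ω => ih (s + X ω)
      _ = (1 + m) ^ T * ∫ ω, Real.cosh ‖s + X ω‖ ∂μ := integral_const_mul _ _
      _ ≤ (1 + m) ^ T * ((1 + m) * Real.cosh ‖s‖) := by
          gcongr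
          exact integral_cosh_norm_add_le hX hB h0 hm s
      _ = _ := by ring

/-- Bernstein's inequality for bounded centred vectors in a Hilbert space, with the tail bound
`2 exp (-T ε² / (2 (v + B ε / 2)))` and no dependence on the dimension. -/
theorem measure_norm_sum_ge_le {Ω H : Type*} [MeasurableSpace Ω] [NormedAddCommGroup H]
    [InnerProductSpace ℝ H] [CompleteSpace H]
    {μ : Measure Ω} [IsProbabilityMeasure μ]
    {X : Ω → H} (hX : StronglyMeasurable X) {B v : ℝ} (hB : ∀ ω, ‖X ω‖ ≤ B) (hB0 : 0 ≤ B)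
    (h0 : ∫ ω, X ω ∂μ = 0) (hv : ∫ ω, ‖X ω‖ ^ 2 ∂μ ≤ v) (hv0 : 0 < v) (T : ℕ) {ε : ℝ}
    (hε : 0 < ε) :
    (Measure.pi fun _ : Fin T => μ).real {x | T * ε ≤ ‖∑ i, X (x i)‖} ≤
      2 * Real.exp (-(T * ε ^ 2 / (2 * (v + B * ε / 2)))) := by
  set D := v + B * ε / 2 with hD
  have hD0 : 0 < D := by positivity
  -- the optimal exponent: `1 - l B / 2 = v / D`
  set l := ε / D with hl
  have hl0 : 0 < l := by positivity
  have hlB : l * B < 2 := by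
    rw [hl, div_mul_eq_mul_div, div_lt_iff₀ hD0]; linarith [mul_comm ε B]
  have hlD : 1 - l * B / 2 = v / D := by rw [hl]; field_simp; rw [hD]; ring
  set m := l ^ 2 * v / 2 / (1 - l * B / 2) with hm
  have hm' : m = l * ε / 2 := by rw [hm, hlD, hl]; field_simp
  have hm0 : 0 ≤ m := by rw [hm']; positivity
  have hY : StronglyMeasurable fun ω => l • X ω := hX.const_smul l
  have hYn : ∀ ω, ‖l • X ω‖ = l * ‖X ω‖ := fun ω => by
    rw [norm_smul, Real.norm_eq_abs, abs_of_pos hl0]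
  have hYB : ∀ ω, ‖l • X ω‖ ≤ l * B := fun ω => by
    rw [hYn]; exact mul_le_mul_of_nonneg_left (hB ω) hl0.le
  have hXi : Integrable (fun ω => ‖X ω‖ ^ 2) μ := by
    refine .of_bound (hX.norm.pow 2).aestronglyMeasurable (B ^ 2) (.of_forall fun ω => ?_)
    rw [Real.norm_eq_abs, abs_of_nonneg (by positivity)]
    exact pow_le_pow_left₀ (norm_nonneg _) (hB ω) 2
  have hden : 0 < 1 - l * B / 2 := by linarith
  have hmY : ∫ ω, (Real.exp ‖l • X ω‖ - 1 - ‖l • X ω‖) ∂μ ≤ m := by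
    calc _ ≤ ∫ ω, l ^ 2 / 2 / (1 - l * B / 2) * ‖X ω‖ ^ 2 ∂μ := by
          refine integral_mono_of_nonneg (.of_forall fun ω => ?_) (hXi.const_mul _)
            (.of_forall fun ω => ?_)
          · have := Real.add_one_le_exp ‖l • X ω‖
            simp only [Pi.zero_apply]; linarith
          · refine (exp_sub_one_sub_le (norm_nonneg _) (hYB ω) hlB).trans (le_of_eq ?_)
            rw [hYn]; ring
      _ = l ^ 2 / 2 / (1 - l * B / 2) * ∫ ω, ‖X ω‖ ^ 2 ∂μ := integral_const_mul _ _
      _ ≤ l ^ 2 / 2 / (1 - l * B / 2) * v := by gcongr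
      _ = m := by rw [hm]; ring
  have hmain := integral_cosh_norm_sum_le hY hYB (by rw [integral_smul, h0, smul_zero]) hmY hm0 T 0
  simp only [zero_add, norm_zero, Real.cosh_zero, mul_one] at hmain
  set f : (Fin T → Ω) → ℝ := fun x => Real.cosh ‖∑ i, l • X (x i)‖ with hf
  have hfi : Integrable f (Measure.pi fun _ : Fin T => μ) := by
    refine .of_bound (Real.continuous_cosh.comp_stronglyMeasurable
      (stronglyMeasurable_sum_pi hY T).norm).aestronglyMeasurable
      (Real.cosh (T * (l * B))) (.of_forall fun x => ?_)
    rw [Real.norm_eq_abs, abs_of_pos (Real.cosh_pos _), Real.cosh_le_cosh, abs_norm]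
    refine le_trans ?_ (le_abs_self _)
    refine (norm_sum_le_of_le _ fun i _ => hYB (x i)).trans ?_
    simp
  have hmk := mul_meas_ge_le_integral_of_nonneg (μ := Measure.pi fun _ : Fin T => μ)
    (.of_forall fun x => (Real.cosh_pos _).le : 0 ≤ᵐ[_] f) hfi (Real.cosh (l * (T * ε)))
  have hsub : {x : Fin T → Ω | T * ε ≤ ‖∑ i, X (x i)‖} ⊆ {x | Real.cosh (l * (T * ε)) ≤ f x} := by
    intro x hx
    simp only [Set.mem_ofPred_eq, hf] at hx ⊢
    rw [Real.cosh_le_cosh, ← Finset.smul_sum, norm_smul, Real.norm_eq_abs, abs_of_pos hl0,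
      abs_of_nonneg (by positivity), abs_of_nonneg (by positivity)]
    gcongr
  have hle := measureReal_mono hsub (measure_ne_top (Measure.pi fun _ : Fin T => μ) _)
  refine hle.trans ?_
  have hcosh : Real.exp (l * (T * ε)) / 2 ≤ Real.cosh (l * (T * ε)) := by
    rw [Real.cosh_eq]; linarith [Real.exp_pos (-(l * (T * ε)))]
  have hpow : (1 + m) ^ T ≤ Real.exp (T * m) := by
    rw [Real.exp_nat_mul]
    exact pow_le_pow_left₀ (by positivity) (by linarith [Real.add_one_le_exp m]) T
  have hfin : Real.exp (l * (T * ε)) / 2 *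
      (Measure.pi fun _ : Fin T => μ).real {x | Real.cosh (l * (T * ε)) ≤ f x} ≤
      Real.exp (T * m) :=
    ((mul_le_mul_of_nonneg_right hcosh measureReal_nonneg).trans hmk).trans (hmain.trans hpow)
  have hexp : 2 * Real.exp (-(T * ε ^ 2 / (2 * D))) =
      Real.exp (T * m) / (Real.exp (l * (T * ε)) / 2) := by
    rw [div_div_eq_mul_div, mul_comm _ (2 : ℝ), mul_div_assoc (2 : ℝ) (Real.exp _),
      ← Real.exp_sub, hm']
    congr 2
    rw [hl]; field_simp; ring
  rw [hexp, le_div_iff₀ (by positivity), mul_comm]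
  exact hfin

/-! ### The law of the outcomes and the expectation of a snapshot -/

theorem continuous_gen_pow_apply (n k i : ℕ) :
    Continuous fun α : ℂ => (gen α ^ k) (Finsupp.single n 1) i := by
  induction k generalizing i with
  | zero => simpa using continuous_const
  | succ k ih =>
    simp only [pow_succ', Module.End.mul_apply, gen_apply]
    exact (continuous_id.mul (continuous_const.mul (ih _))).sub
      (Complex.continuous_conj.mul (continuous_const.mul (ih _)))

theorem continuous_displacementTerm (n k : ℕ) : Continuous fun α => displacementTerm α n k := by
  have h : ∀ α, displacementTerm α n k =
      ∑ i ∈ Finset.range (n + k + 1), displacementTerm α n k i • fock i := by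
    intro α
    ext j
    rw [← inner_fock j (∑ i ∈ _, _), inner_sum]
    simp only [inner_smul_right, inner_fock, fock_apply, mul_ite, mul_one, mul_zero]
    rw [Finset.sum_ite_eq]
    split_ifs with hj
    · rfl
    · rw [displacementTerm_apply, gen_pow_apply_eq_zero α n k j (by simp at hj; omega), mul_zero]
  rw [funext h]
  simp only [displacementTerm_apply]
  exact continuous_finsetSum _ fun i _ =>
    (continuous_const.mul (continuous_gen_pow_apply n k i)).smul continuous_const

theorem stronglyMeasurable_displacedFock (n : ℕ) :
    StronglyMeasurable fun α => displacedFock α n :=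
  stronglyMeasurable_of_tendsto atTop
    (f := fun K α => ∑ k ∈ Finset.range K, displacementTerm α n k)
    (fun _ => (continuous_finsetSum _ fun k _ =>
      continuous_displacementTerm n k).stronglyMeasurable)
    (tendsto_pi_nhds.mpr fun α => (hasSum_displacementTerm α n).tendsto_sum_nat)

theorem stronglyMeasurable_displacedFock_apply (n i : ℕ) :
    StronglyMeasurable fun α => displacedFock α n i := by
  simpa only [inner_fock] using
    (stronglyMeasurable_const (b := fock i)).inner (𝕜 := ℂ) (stronglyMeasurable_displacedFock n)

theorem measurable_photonProb (ρ : Fock →L[ℂ] Fock) (n : ℕ) :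
    Measurable fun α => photonProb ρ n α :=
  (Complex.continuous_re.comp_stronglyMeasurable ((stronglyMeasurable_displacedFock n).inner
    (𝕜 := ℂ) (ρ.continuous.comp_stronglyMeasurable
      (stronglyMeasurable_displacedFock n)))).measurable

theorem stronglyMeasurable_geomElem (q : ℝ) (i j : ℕ) :
    StronglyMeasurable fun α => geomElem q α i j :=
  stronglyMeasurable_of_tendsto atTop
    (f := fun K α => ∑ n ∈ Finset.range K,
      (q : ℂ) ^ n * (displacedFock α n i * (starRingEnd ℂ) (displacedFock α n j)))
    (fun _ => Finset.stronglyMeasurable_fun_sum _ fun n _ => stronglyMeasurable_const.mul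
      ((stronglyMeasurable_displacedFock_apply n i).mul
        (Complex.continuous_conj.comp_stronglyMeasurable
          (stronglyMeasurable_displacedFock_apply n j))))
    (tendsto_pi_nhds.mpr fun α => (hasSum_geomElem q α i j).tendsto_sum_nat)

theorem stronglyMeasurable_dualMatrix (r : ℝ) (N : ℕ) :
    StronglyMeasurable fun α => dualMatrix r N α := by
  have h : ∀ α, dualMatrix r N α = (2 / (Real.pi * (1 + -r))) • ∑ i : Fin N, ∑ j : Fin N,
      geomElem (-((1 - -r) / (1 + -r))) α i j • Matrix.single i j (1 : ℂ) := by
    intro α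
    rw [dualMatrix, tMatrix_eq]
    congr 1
    conv_lhs => rw [Matrix.matrix_eq_sum_single (Matrix.of _)]
    simp [Matrix.smul_single]
  rw [funext h]
  have hsum : StronglyMeasurable fun α => ∑ i : Fin N, ∑ j : Fin N,
      geomElem (-((1 - -r) / (1 + -r))) α i j • Matrix.single i j (1 : ℂ) :=
    Finset.stronglyMeasurable_fun_sum _ fun i _ => Finset.stronglyMeasurable_fun_sum _ fun j _ =>
      (stronglyMeasurable_geomElem _ i j).smul_const _
  exact hsum.const_smul (2 / (Real.pi * (1 + -r)))

theorem snapshot_eq (A r : ℝ) (N : ℕ) (M : ℕ∞) (x : ℕ × ℂ) : snapshot A r N M x =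
    (open Classical in if (x.1 : ℕ∞) < M then A * eig r x.1 else 0) • dualMatrix r N x.2 := by
  unfold snapshot
  split_ifs <;> simp

theorem stronglyMeasurable_snapshot (A r : ℝ) (N : ℕ) (M : ℕ∞) :
    StronglyMeasurable (snapshot A r N M) := by
  rw [funext (snapshot_eq A r N M)]
  exact ((measurable_of_countable fun n : ℕ =>
    (open Classical in if (n : ℕ∞) < M then A * eig r n else 0)).comp
      measurable_fst).stronglyMeasurable.smul
        ((stronglyMeasurable_dualMatrix r N).comp_measurable measurable_snd)

theorem measurable_photonProb_prod (ρ : Fock →L[ℂ] Fock) :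
    Measurable fun x : ℕ × ℂ => ENNReal.ofReal (photonProb ρ x.1 x.2) :=
  ENNReal.measurable_ofReal.comp
    (measurable_from_prod_countable_right fun n => measurable_photonProb ρ n)

theorem isProbabilityMeasure_outcomeLaw {ρ : Fock →L[ℂ] Fock} (hρ : IsDensityOperator ρ)
    {𝒜 : Set ℂ} (h0 : volume 𝒜 ≠ 0) (hfin : volume 𝒜 ≠ ∞) :
    IsProbabilityMeasure (outcomeLaw ρ 𝒜) := by
  have := ProbabilityTheory.cond_isProbabilityMeasure_of_finite h0 hfin
  refine ⟨?_⟩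
  rw [outcomeLaw, withDensity_apply _ MeasurableSet.univ, Measure.restrict_univ,
    lintegral_prod_symm' _ (measurable_photonProb_prod ρ)]
  simp_rw [lintegral_count, tsum_ofReal_photonProb hρ]
  simp

theorem integral_count_nat {E : Type*} [NormedAddCommGroup E] [NormedSpace ℝ E] [CompleteSpace E]
    {f : ℕ → E} (hf : Integrable f Measure.count) : ∫ n, f n ∂Measure.count = ∑' n, f n := by
  rw [integral_countable hf]
  simp

theorem integrable_snapshot {A r : ℝ} (hA : 0 ≤ A) (hr : |r| < 1) {N : ℕ} {M : ℕ∞}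
    (hM : M = N ∨ (r = 0 ∧ M = ⊤)) (μ : Measure (ℕ × ℂ)) [IsFiniteMeasure μ] :
    Integrable (snapshot A r N M) μ :=
  .of_bound (stronglyMeasurable_snapshot A r N M).aestronglyMeasurable _
    (.of_forall (norm_snapshot_le hA hr hM))

theorem integral_snapshot {ρ : Fock →L[ℂ] Fock} (hρ : IsDensityOperator ρ)
    {𝒜 : Set ℂ} (h0 : volume 𝒜 ≠ 0) (hfin : volume 𝒜 ≠ ∞) {κ A r : ℝ} (hκ : 0 < κ)
    (hA : A = κ * (volume 𝒜).toReal) (hr : |r| < 1) {N : ℕ} {M : ℕ∞}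
    (hM : M = N ∨ (r = 0 ∧ M = ⊤)) :
    ∫ x, snapshot A r N M x ∂(outcomeLaw ρ 𝒜) = truncExpansion κ r N M ρ 𝒜 := by
  have hprob := isProbabilityMeasure_outcomeLaw hρ h0 hfin
  have hcond := ProbabilityTheory.cond_isProbabilityMeasure_of_finite h0 hfin
  have hA0 : 0 ≤ A := by rw [hA]; positivity
  have hint := integrable_snapshot hA0 hr hM (outcomeLaw ρ 𝒜)
  have hlt : ∀ᵐ x ∂((Measure.count : Measure ℕ).prod (ProbabilityTheory.cond volume 𝒜)),
      ENNReal.ofReal (photonProb ρ x.1 x.2) < ∞ := .of_forall fun _ => ENNReal.ofReal_lt_top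
  rw [outcomeLaw] at hint ⊢
  rw [integrable_withDensity_iff_integrable_smul' (measurable_photonProb_prod ρ) hlt] at hint
  rw [integral_withDensity_eq_integral_toReal_smul (measurable_photonProb_prod ρ) hlt,
    integral_prod_symm _ hint]
  have hinner : ∀ᵐ α ∂(ProbabilityTheory.cond volume 𝒜),
      ∫ n, (ENNReal.ofReal (photonProb ρ n α)).toReal • snapshot A r N M (n, α)
        ∂(Measure.count : Measure ℕ) =
      A • ((open Classical in
        ∑' n : ℕ, if (n : ℕ∞) < M then photonProb ρ n α * eig r n else 0) •
          dualMatrix r N α) := by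
    filter_upwards [hint.prod_left_ae] with α hα
    have hsum : Summable fun n : ℕ =>
        (open Classical in if (n : ℕ∞) < M then photonProb ρ n α * eig r n else 0) := by
      rcases hM with rfl | ⟨rfl, rfl⟩
      · refine summable_of_ne_finset_zero (s := Finset.range N) fun n hn => ?_
        rw [if_neg]
        simpa using hn
      · refine Summable.of_norm_bounded
          (g := fun n => photonProb ρ n α * (2 / Real.pi)) ((summable_photonProb hρ α).mul_right _)
          fun n => ?_
        simp [eig, abs_of_nonneg (photonProb_nonneg hρ n α), abs_of_pos Real.pi_pos]
    rw [integral_count_nat hα, ← hsum.tsum_smul_const, ← tsum_const_smul'']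
    refine tsum_congr fun n => ?_
    rw [ENNReal.toReal_ofReal (photonProb_nonneg hρ n α), snapshot_eq, smul_smul, smul_smul]
    congr 1
    split_ifs
    · ring
    · simp
  rw [integral_congr_ae hinner, integral_smul, truncExpansion, ProbabilityTheory.cond,
    integral_smul_measure, smul_smul, hA, ENNReal.toReal_inv, mul_assoc,
    mul_inv_cancel₀ (ENNReal.toReal_pos h0 hfin).ne', mul_one]

/-! ### Comparison of the operator norm with the Frobenius norm -/

/-- A matrix as a vector of its entries; the Euclidean norm becomes the Frobenius norm. -/
noncomputable def toVec (N : ℕ) :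
    Matrix (Fin N) (Fin N) ℂ →L[ℝ] EuclideanSpace ℂ (Fin N × Fin N) :=
  LinearMap.toContinuousLinearMap
    { toFun := fun B => WithLp.toLp 2 fun p : Fin N × Fin N => B p.1 p.2
      map_add' := fun _ _ => rfl
      map_smul' := fun _ _ => rfl }

theorem norm_le_norm_toVec {N : ℕ} (B : Matrix (Fin N) (Fin N) ℂ) : ‖B‖ ≤ ‖toVec N B‖ := by
  refine norm_le_of_forall_sesq B (norm_nonneg _) fun u v => ?_
  rw [← Fintype.sum_prod_type' (f := fun i j => (starRingEnd ℂ) (u i) * B i j * v j)]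
  calc _ ≤ ∑ p : Fin N × Fin N, ‖B p.1 p.2‖ * (‖u p.1‖ * ‖v p.2‖) := by
        refine norm_sum_le_of_le _ fun p _ => le_of_eq ?_
        rw [norm_mul, norm_mul, RCLike.norm_conj]; ring
    _ ≤ √(∑ p : Fin N × Fin N, ‖B p.1 p.2‖ ^ 2) *
        √(∑ p : Fin N × Fin N, (‖u p.1‖ * ‖v p.2‖) ^ 2) := Real.sum_mul_le_sqrt_mul_sqrt _ _ _
    _ = ‖toVec N B‖ * (‖u‖ * ‖v‖) := by
        have h1 : ∑ p : Fin N × Fin N, (‖u p.1‖ * ‖v p.2‖) ^ 2 =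
            (∑ i, ‖u i‖ ^ 2) * ∑ j, ‖v j‖ ^ 2 := by
          rw [Finset.sum_mul_sum, Fintype.sum_prod_type]
          simp only [mul_pow]
        rw [h1, Real.sqrt_mul (Finset.sum_nonneg fun _ _ => by positivity),
          ← EuclideanSpace.norm_eq, ← EuclideanSpace.norm_eq, EuclideanSpace.norm_eq (toVec N B)]
        rfl
    _ = _ := by ring

theorem norm_toVec_le {N : ℕ} (B : Matrix (Fin N) (Fin N) ℂ) : ‖toVec N B‖ ≤ √N * ‖B‖ := by
  have hcol : ∀ j : Fin N, ∑ i, ‖B i j‖ ^ 2 ≤ ‖B‖ ^ 2 := fun j => by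
    have h := Matrix.l2_opNorm_mulVec B (EuclideanSpace.single j (1 : ℂ))
    rw [PiLp.norm_single, norm_one, mul_one, EuclideanSpace.norm_eq] at h
    have h2 := (Real.sqrt_le_left (norm_nonneg _)).mp h
    simpa using h2
  rw [EuclideanSpace.norm_eq]
  refine Real.sqrt_le_iff.mpr ⟨by positivity, ?_⟩
  rw [Fintype.sum_prod_type_right, mul_pow, Real.sq_sqrt (Nat.cast_nonneg _)]
  refine (Finset.sum_le_sum fun j _ => hcol j).trans ?_
  simp

/-- The second moment about the mean is at most the second moment. -/
theorem integral_norm_sub_mean_sq_le {Ω H : Type*} [MeasurableSpace Ω] [NormedAddCommGroup H]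
    [InnerProductSpace ℝ H] [CompleteSpace H] {μ : Measure Ω} [IsProbabilityMeasure μ]
    {Y : Ω → H} (hY : Integrable Y μ) (hY2 : Integrable (fun ω => ‖Y ω‖ ^ 2) μ) :
    ∫ ω, ‖Y ω - ∫ ω', Y ω' ∂μ‖ ^ 2 ∂μ ≤ ∫ ω, ‖Y ω‖ ^ 2 ∂μ := by
  set m := ∫ ω', Y ω' ∂μ with hm
  have h1 : Integrable (fun ω => 2 * inner ℝ m (Y ω)) μ := (hY.const_inner m).const_mul 2
  have h2 : Integrable (fun ω => ‖Y ω‖ ^ 2 - 2 * inner ℝ m (Y ω)) μ := hY2.sub h1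
  have h3 : ∀ ω, ‖Y ω - m‖ ^ 2 = ‖Y ω‖ ^ 2 - 2 * inner ℝ m (Y ω) + ‖m‖ ^ 2 := fun ω => by
    rw [norm_sub_sq_real, real_inner_comm]
  simp_rw [h3]
  rw [integral_add h2 (integrable_const _), integral_sub hY2 h1, integral_const_mul,
    integral_inner hY, ← hm, real_inner_self_eq_norm_sq]
  simp
  nlinarith [sq_nonneg ‖m‖]

/-! ### The stated bounds against the snapshot bound -/

theorem abs_eig_zero {r : ℝ} : |eig |r| 0| = 2 / (Real.pi * (1 + |r|)) := by
  rw [eig, pow_zero, pow_zero, pow_zero, mul_one, mul_one, mul_one, abs_of_pos]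
  positivity

theorem abs_eig_neg {r : ℝ} (hr : |r| < 1) (n : ℕ) :
    |eig (-|r|) n| = 2 / (Real.pi * (1 - |r|)) * growth r ^ n := by
  have h1 : 0 < 1 - |r| := by linarith
  rw [eig_eq, sub_neg_eq_add, ← sub_eq_add_neg, abs_mul, abs_pow, abs_neg, growth,
    abs_of_pos (a := 2 / (Real.pi * (1 - |r|))) (by positivity),
    abs_of_pos (a := (1 + |r|) / (1 - |r|)) (by positivity)]

theorem mul_abs_eig_eq {A r : ℝ} (hr : |r| < 1) {N : ℕ} (hN : 1 ≤ N) :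
    A * |eig (-|r|) N * eig |r| 0| = growth r * snapBound A r N := by
  have h1 : 0 < 1 - |r| := by linarith
  have h2 : 0 < 1 + |r| := by positivity
  obtain ⟨n, rfl⟩ := Nat.exists_eq_add_of_le' hN
  rw [abs_mul, abs_eig_zero, abs_eig_neg hr, snapBound, Nat.add_sub_cancel, pow_succ,
    ← sq_abs r, show (1 : ℝ) - |r| ^ 2 = (1 - |r|) * (1 + |r|) by ring]
  field_simp
  ring

theorem snapBound_le_mul_abs_eig {A r : ℝ} (hA : 0 ≤ A) (hr : |r| < 1) {N : ℕ} (hN : 1 ≤ N) :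
    snapBound A r N ≤ A * |eig (-|r|) N * eig |r| 0| := by
  rw [mul_abs_eig_eq hr hN]
  exact le_mul_of_one_le_left (snapBound_nonneg hA hr N) (one_le_growth hr)

theorem rangeBound_eq {A r : ℝ} (hr : |r| < 1) {N : ℕ} (hN : 1 ≤ N) :
    rangeBound A r N = growth r * snapBound A r N + A := by
  rw [← mul_abs_eig_eq hr hN, abs_mul, abs_eig_zero, rangeBound]
  ring

theorem sq_mul_abs_eig_eq_varianceBound {A r : ℝ} (hr : |r| < 1) (N : ℕ) :
    A ^ 2 * |eig |r| 0 * eig (-|r|) N| ^ 2 = varianceBound A r N := by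
  have h1 : 0 < 1 - |r| := by linarith
  rw [abs_mul, abs_eig_zero, abs_eig_neg hr, varianceBound, ← growth,
    show (1 : ℝ) - |r| ^ 2 = (1 - |r|) * (1 + |r|) by ring, pow_mul']
  field_simp
  ring

/-- The range term of Bernstein's inequality for the Frobenius norm is covered by that of the sample
bound. This is where the gain of a factor `growth r` in `snapBound` enters: if `growth r` is close
to `1` the summand `A` of the range bound is needed. -/
theorem sqrt_mul_snapBound_le {A r : ℝ} (hA : 0 ≤ A) (hr : |r| < 1) {N : ℕ} (hN : 1 ≤ N) :
    √N * snapBound A r N ≤ N * rangeBound A r N / 2 := by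
  set b := snapBound A r N with hb
  have hb0 : 0 ≤ b := snapBound_nonneg hA hr N
  have hp := one_le_growth hr
  set p := growth r with hpdef
  rw [rangeBound_eq hr hN, ← hb, ← hpdef]
  have hs : √(N : ℝ) ^ 2 = N := Real.sq_sqrt (Nat.cast_nonneg _)
  have hs1 : 1 ≤ √(N : ℝ) := Real.one_le_sqrt.mpr (by exact_mod_cast hN)
  have hden : 0 < 1 - |r| := by linarith
  have hpr : p * (1 - |r|) = 1 + |r| := by rw [hpdef, growth]; field_simp
  have hr0 := abs_nonneg r
  have hsq : r ^ 2 < 1 := (sq_lt_one_iff_abs_lt_one r).mpr hr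
  have hπ := Real.pi_gt_three
  -- the summand `A`, measured in units of the snapshot bound
  have hA' : A * (4 * p ^ (N - 1)) = b * (Real.pi ^ 2 * (1 - r ^ 2)) := by
    have h1 : 1 - r ^ 2 ≠ 0 := by linarith
    rw [hb, snapBound, ← hpdef]
    field_simp
  have hπ2 : (9 : ℝ) < Real.pi ^ 2 := by nlinarith
  suffices h : 2 * b ≤ √N * (p * b + A) by
    nlinarith [mul_le_mul_of_nonneg_left h (Real.sqrt_nonneg (N : ℝ))]
  by_cases h2 : 2 ≤ p
  · nlinarith [mul_nonneg (sub_nonneg.mpr hs1) (mul_nonneg (by linarith : 0 ≤ p) hb0),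
      mul_nonneg (sub_nonneg.mpr h2) hb0, mul_nonneg (Real.sqrt_nonneg (N : ℝ)) hA]
  push Not at h2
  have hr3 : |r| < 1 / 3 := by nlinarith
  have hr3' : r ^ 2 ≤ 1 / 9 := by rw [← sq_abs]; nlinarith
  rcases le_or_gt 4 N with h4 | h4
  · have hs2 : 2 ≤ √(N : ℝ) := Real.le_sqrt_of_sq_le (by
      have : (4 : ℝ) ≤ N := by exact_mod_cast h4
      linarith)
    nlinarith [mul_nonneg (sub_nonneg.mpr hs2) (mul_nonneg (by linarith : 0 ≤ p) hb0),
      mul_nonneg (sub_nonneg.mpr hp) hb0, mul_nonneg (Real.sqrt_nonneg (N : ℝ)) hA]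
  have h8 : 8 * b ≤ b * (Real.pi ^ 2 * (1 - r ^ 2)) := by
    have : 8 ≤ Real.pi ^ 2 * (1 - r ^ 2) := by nlinarith
    nlinarith
  by_cases h1 : N = 1
  · subst h1
    simp at hA' ⊢
    nlinarith [mul_nonneg (sub_nonneg.mpr hp) hb0]
  have hs2 : 4 / 3 ≤ √(N : ℝ) := Real.le_sqrt_of_sq_le (by
    have : (2 : ℝ) ≤ N := by exact_mod_cast (by omega : 2 ≤ N)
    linarith)
  by_cases h3 : 3 / 2 ≤ p
  · nlinarith [mul_nonneg (sub_nonneg.mpr hs2) (mul_nonneg (by linarith : 0 ≤ p) hb0),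
      mul_nonneg (sub_nonneg.mpr h3) hb0, mul_nonneg (Real.sqrt_nonneg (N : ℝ)) hA]
  push Not at h3
  have hpow : p ^ (N - 1) ≤ 9 / 4 := by
    have : p ^ (N - 1) ≤ p ^ 2 := pow_le_pow_right₀ hp (by omega)
    nlinarith
  have hAb : 8 * b ≤ 9 * A := by
    nlinarith [mul_le_mul_of_nonneg_left hpow hA]
  nlinarith [mul_nonneg (sub_nonneg.mpr hs2) (add_nonneg (mul_nonneg (by linarith : 0 ≤ p) hb0) hA),
    mul_nonneg (sub_nonneg.mpr hp) hb0]

theorem log_pos {N : ℕ} (hN : 1 ≤ N) {δ : ℝ} (hδ : 0 < δ) (hδ1 : δ < 1) :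
    0 < Real.log (2 * N / δ) := by
  have : (1 : ℝ) ≤ N := by exact_mod_cast hN
  exact Real.log_pos (by rw [lt_div_iff₀ hδ]; linarith)

/-! ### Sample size -/

/-- Concentration in operator norm: Bernstein's inequality for the Frobenius norm. -/
theorem le_measure_norm_shadow_sub_le {μ : Measure (ℕ × ℂ)} [IsProbabilityMeasure μ] {A r : ℝ}
    (hA : 0 < A) (hr : |r| < 1) {N : ℕ} (hN : 1 ≤ N) {M : ℕ∞} (hM : M = N ∨ (r = 0 ∧ M = ⊤))
    {ε δ : ℝ} (hε : 0 < ε) (hδ : 0 < δ) (hδ1 : δ < 1) {T : ℕ} (hT : sampleBound A r N ε δ ≤ T) :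
    ENNReal.ofReal (1 - δ) ≤ Measure.pi (fun _ : Fin T => μ)
      {x | ‖shadow A r N M x - ∫ y, snapshot A r N M y ∂μ‖ ≤ ε} := by
  set b := snapBound A r N with hb
  have hb0 : 0 < b := by
    have h1 := one_le_growth hr
    have h2 : r ^ 2 < 1 := (sq_lt_one_iff_abs_lt_one r).mpr hr
    have : 0 < 1 - r ^ 2 := by linarith
    rw [hb]; unfold snapBound; positivity
  have hN' : (1 : ℝ) ≤ N := by exact_mod_cast hN
  have hlog := log_pos hN hδ hδ1
  have hint := integrable_snapshot hA.le hr hM μ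
  set E := ∫ y, snapshot A r N M y ∂μ with hE
  set Y : ℕ × ℂ → EuclideanSpace ℂ (Fin N × Fin N) := fun y => toVec N (snapshot A r N M y) with hY
  have hYm : StronglyMeasurable Y :=
    (toVec N).continuous.comp_stronglyMeasurable (stronglyMeasurable_snapshot A r N M)
  have hYi : Integrable Y μ := (toVec N).integrable_comp hint
  have hYmean : ∫ y, Y y ∂μ = toVec N E := (toVec N).integral_comp_comm hint
  have hYb : ∀ y, ‖Y y‖ ≤ √N * b := fun y =>
    (norm_toVec_le _).trans (by gcongr; exact norm_snapshot_le hA.le hr hM y)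
  have hEb : ‖E‖ ≤ b := by
    refine (norm_integral_le_of_norm_le_const (.of_forall (norm_snapshot_le hA.le hr hM))).trans ?_
    simp [hb]
  have hY2b : ∀ y, ‖Y y‖ ^ 2 ≤ N * b ^ 2 := fun y => by
    refine (pow_le_pow_left₀ (norm_nonneg _) (hYb y) 2).trans (le_of_eq ?_)
    rw [mul_pow, Real.sq_sqrt (by positivity)]
  have hY2i : Integrable (fun y => ‖Y y‖ ^ 2) μ :=
    .of_bound (hYm.norm.pow 2).aestronglyMeasurable (N * b ^ 2) (.of_forall fun y => by
      rw [Real.norm_eq_abs, abs_of_nonneg (by positivity)]; exact hY2b y)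
  set X : ℕ × ℂ → EuclideanSpace ℂ (Fin N × Fin N) := fun y => Y y - toVec N E with hX
  have hXm : StronglyMeasurable X := hYm.sub stronglyMeasurable_const
  have hXb : ∀ y, ‖X y‖ ≤ 2 * (√N * b) := fun y => by
    refine (norm_sub_le _ _).trans ?_
    have : ‖toVec N E‖ ≤ √N * b := (norm_toVec_le _).trans (by gcongr)
    linarith [hYb y]
  have hX0 : ∫ y, X y ∂μ = 0 := by
    rw [hX, integral_sub hYi (integrable_const _), hYmean]; simp
  have hXv : ∫ y, ‖X y‖ ^ 2 ∂μ ≤ N * b ^ 2 := by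
    have h1 := integral_norm_sub_mean_sq_le hYi hY2i
    rw [hYmean] at h1
    refine h1.trans ((integral_mono hY2i (integrable_const _) hY2b).trans ?_)
    simp
  have hbern := measure_norm_sum_ge_le hXm hXb (by positivity) hX0 hXv (by positivity) T hε
  set D := N * b ^ 2 + 2 * (√N * b) * ε / 2 with hD
  have hD0 : 0 < D := by positivity
  -- the sample bound dominates the one required by Bernstein's inequality
  have hDle : D ≤ N ^ 2 * (varianceBound A r N + rangeBound A r N * ε / (2 * N)) := by
    have h1 : N * b ^ 2 ≤ N ^ 2 * varianceBound A r N := by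
      rw [← sq_mul_abs_eig_eq_varianceBound hr, mul_comm (eig |r| 0), ← mul_pow]
      have := pow_le_pow_left₀ hb0.le (snapBound_le_mul_abs_eig hA.le hr hN) 2
      have h3 : (N : ℝ) ≤ N ^ 2 := by nlinarith
      gcongr
    have h2 := mul_le_mul_of_nonneg_right (sqrt_mul_snapBound_le hA.le hr hN) hε.le
    have h3 : (N : ℝ) ^ 2 * (rangeBound A r N * ε / (2 * N)) = N * rangeBound A r N / 2 * ε := by
      field_simp
    rw [mul_add, h3, hD]
    linarith
  have hTD : Real.log (2 * N / δ) ≤ T * ε ^ 2 / (2 * D) := by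
    rw [le_div_iff₀ (by positivity)]
    have h1 : 2 * D / ε ^ 2 * Real.log (2 * N / δ) ≤ T := by
      refine le_trans ?_ hT
      rw [sampleBound, mul_assoc 2]
      gcongr
    rw [div_mul_eq_mul_div, div_le_iff₀ (by positivity)] at h1
    linarith
  have hT0 : (0 : ℝ) < T := by
    by_contra h
    have h0 : (T : ℝ) = 0 := le_antisymm (not_lt.mp h) (Nat.cast_nonneg _)
    rw [h0] at hTD
    simp at hTD; linarith
  have hexp : 2 * Real.exp (-(T * ε ^ 2 / (2 * D))) ≤ δ := by
    have h1 : Real.exp (-(T * ε ^ 2 / (2 * D))) ≤ Real.exp (-Real.log (2 * N / δ)) :=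
      Real.exp_le_exp.mpr (neg_le_neg hTD)
    rw [Real.exp_neg (Real.log _), Real.exp_log (by positivity), inv_div] at h1
    have h2 : δ / (2 * N) ≤ δ / 2 := by
      gcongr; linarith
    linarith
  set P := Measure.pi (fun _ : Fin T => μ) with hP
  set Bad : Set (Fin T → ℕ × ℂ) := {x | T * ε ≤ ‖∑ i, X (x i)‖} with hBad
  have hBm : MeasurableSet Bad :=
    measurableSet_le measurable_const (stronglyMeasurable_sum_pi hXm T).norm.measurable
  have hgood : Badᶜ ⊆ {x | ‖shadow A r N M x - E‖ ≤ ε} := by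
    intro x hx
    have hx' : ‖∑ i, X (x i)‖ < T * ε := not_le.mp hx
    have he : toVec N (shadow A r N M x - E) = (T : ℝ)⁻¹ • ∑ i, X (x i) := by
      simp only [hX, hY, Finset.sum_sub_distrib, shadow, map_sub, map_smul, map_sum, smul_sub]
      simp [← Nat.cast_smul_eq_nsmul ℝ, smul_smul, hT0.ne']
    refine (norm_le_norm_toVec _).trans ?_
    rw [he, norm_smul, Real.norm_eq_abs, abs_of_pos (by positivity), inv_mul_le_iff₀ hT0]
    exact hx'.le
  refine le_trans ?_ (measure_mono hgood)
  rw [← ofReal_measureReal, probReal_compl_eq_one_sub hBm]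
  exact ENNReal.ofReal_le_ofReal (by linarith)

/-! ### Growth of the sample size -/

/-- The product `|λ_{-|r|}^{(N)} λ_{|r|}^{(0)}|` of the eigenvalue bounds. -/
noncomputable def level (r : ℝ) (N : ℕ) : ℝ := |eig (-|r|) N * eig |r| 0|

theorem level_eq {r : ℝ} (hr : |r| < 1) (N : ℕ) :
    level r N = 4 / (Real.pi ^ 2 * (1 - |r| ^ 2)) * growth r ^ N := by
  have h1 : 0 < 1 - |r| := by linarith
  rw [level, abs_mul, abs_eig_zero, abs_eig_neg hr,
    show (1 : ℝ) - |r| ^ 2 = (1 - |r|) * (1 + |r|) by ring]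
  field_simp
  ring

theorem le_level {r : ℝ} (hr : |r| < 1) (N : ℕ) :
    4 / Real.pi ^ 2 * growth r ^ N ≤ level r N := by
  rw [level_eq hr]
  have h1 := one_le_growth hr
  have h2 : 0 < 1 - |r| ^ 2 := by nlinarith [abs_nonneg r]
  gcongr
  exact mul_le_of_le_one_right (by positivity) (by nlinarith [abs_nonneg r])

theorem rangeBound_eq_level (A r : ℝ) (N : ℕ) : rangeBound A r N = A * level r N + A := by
  rw [rangeBound, level, abs_mul, abs_eig_zero]; ring

theorem varianceBound_eq_level (A : ℝ) {r : ℝ} (hr : |r| < 1) (N : ℕ) :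
    varianceBound A r N = (A * level r N) ^ 2 := by
  rw [← sq_mul_abs_eig_eq_varianceBound hr, level, mul_comm (eig |r| 0), mul_pow]

theorem le_sampleBound {A r : ℝ} (hA : 0 ≤ A) (hr : |r| < 1) {N : ℕ} (hN : 1 ≤ N) {ε δ : ℝ}
    (hε : 0 < ε) (hδ : 0 < δ) (hδ1 : δ < 1) :
    32 * (N : ℝ) ^ 2 * A ^ 2 / (Real.pi ^ 4 * ε ^ 2) * Real.log (2 * N / δ) *
      growth r ^ (2 * N) ≤ sampleBound A r N ε δ := by
  have hlog := log_pos hN hδ hδ1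
  have hg := one_le_growth hr
  have hR : 0 ≤ rangeBound A r N := by
    rw [rangeBound_eq_level]
    have : 0 ≤ level r N := abs_nonneg _
    positivity
  have hV : (A * (4 / Real.pi ^ 2 * growth r ^ N)) ^ 2 ≤ varianceBound A r N := by
    rw [varianceBound_eq_level A hr]
    have := le_level hr N
    gcongr
  calc _ = 2 * (N : ℝ) ^ 2 * ((A * (4 / Real.pi ^ 2 * growth r ^ N)) ^ 2 + 0) / ε ^ 2 *
        Real.log (2 * N / δ) := by
        rw [pow_mul']; field_simp; ring
    _ ≤ _ := by
        unfold sampleBound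
        gcongr
        positivity

theorem isEquivalent_sampleBound {r : ℝ} (hr : |r| < 1) {ε δ : ℝ} (hε : 0 < ε) (hδ : 0 < δ)
    (hδ1 : δ < 1) {c : ℝ} (hc : 0 < c) :
    (fun N : ℕ => sampleBound (c * N) r N ε δ) ~[atTop]
      fun N : ℕ => 32 * c ^ 2 * (N : ℝ) ^ 4 / (Real.pi ^ 4 * ε ^ 2 * (1 - |r| ^ 2) ^ 2) *
        ((1 + |r|) / (1 - |r|)) ^ (2 * N) * Real.log (2 * N / δ) := by
  have hg := one_le_growth hr
  have h1r : 0 < 1 - |r| ^ 2 := by nlinarith [abs_nonneg r]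
  have h1r' : 0 < 1 - |r| := by linarith
  set l : ℝ := 4 / Real.pi ^ 2 with hl
  have hl0 : 0 < l := by positivity
  have hL : ∀ N, l ≤ level r N := fun N =>
    (le_mul_of_one_le_right hl0.le (one_le_pow₀ hg)).trans (le_level hr N)
  refine isEquivalent_of_tendsto_one ?_
  have h0 : Tendsto (fun N : ℕ => (1 / l + 1 / l ^ 2) * ε / (2 * c) * (1 / (N : ℝ)) *
      (1 / (N : ℝ))) atTop (𝓝 0) := by
    have := ((tendsto_one_div_atTop_nhds_zero_nat (𝕜 := ℝ)).const_mul
      ((1 / l + 1 / l ^ 2) * ε / (2 * c))).mul (tendsto_one_div_atTop_nhds_zero_nat (𝕜 := ℝ))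
    rwa [mul_zero] at this
  have h1 : Tendsto (fun N : ℕ => 1 + (1 / l + 1 / l ^ 2) * ε / (2 * c) * (1 / (N : ℝ)) *
      (1 / (N : ℝ))) atTop (𝓝 1) := by
    simpa using h0.const_add 1
  -- the quotient is `1 + R ε / (2 N V)`, and `R / V = (1 / L + 1 / L²) / A` for the level `L`
  have hq : ∀ N : ℕ, 1 ≤ N → sampleBound (c * N) r N ε δ /
      (32 * c ^ 2 * (N : ℝ) ^ 4 / (Real.pi ^ 4 * ε ^ 2 * (1 - |r| ^ 2) ^ 2) *
        ((1 + |r|) / (1 - |r|)) ^ (2 * N) * Real.log (2 * N / δ)) =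
      1 + (1 / level r N + 1 / level r N ^ 2) * ε / (2 * c) * (1 / (N : ℝ)) *
        (1 / (N : ℝ)) := by
    intro N hN
    have hlog := log_pos hN hδ hδ1
    have hN0 : (0 : ℝ) < N := by exact_mod_cast hN
    have hL0 : 0 < level r N := hl0.trans_le (hL N)
    have hden : 32 * c ^ 2 * (N : ℝ) ^ 4 / (Real.pi ^ 4 * ε ^ 2 * (1 - |r| ^ 2) ^ 2) *
        ((1 + |r|) / (1 - |r|)) ^ (2 * N) * Real.log (2 * N / δ) =
        2 * (N : ℝ) ^ 2 * (c * N * level r N) ^ 2 / ε ^ 2 * Real.log (2 * N / δ) := by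
      rw [← varianceBound_eq_level _ hr, varianceBound]
      field_simp
      ring
    rw [hden, sampleBound, rangeBound_eq_level, varianceBound_eq_level _ hr]
    have := hlog.ne'
    field_simp
  refine tendsto_of_tendsto_of_tendsto_of_le_of_le' tendsto_const_nhds h1 ?_ ?_
  · filter_upwards [eventually_ge_atTop 1] with N hN
    simp only [Pi.div_apply]
    rw [hq N hN]
    have hL0 : 0 < level r N := hl0.trans_le (hL N)
    have : 0 ≤ (1 / level r N + 1 / level r N ^ 2) * ε / (2 * c) * (1 / (N : ℝ)) *
        (1 / (N : ℝ)) := by positivity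
    linarith
  · filter_upwards [eventually_ge_atTop 1] with N hN
    simp only [Pi.div_apply]
    rw [hq N hN]
    have := hL N
    gcongr

theorem isTheta_log {δ : ℝ} (hδ : 0 < δ) :
    (fun N : ℕ => Real.log (2 * N / δ)) =Θ[atTop] fun N : ℕ => Real.log N := by
  have h1 : (fun N : ℕ => Real.log (2 * N / δ)) =ᶠ[atTop]
      fun N : ℕ => Real.log N + Real.log (2 / δ) := by
    filter_upwards [eventually_ge_atTop 1] with N hN
    have hN0 : (N : ℝ) ≠ 0 := by positivity
    rw [← Real.log_mul hN0 (by positivity)]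
    congr 1; ring
  have h2 : (fun N : ℕ => Real.log N + Real.log (2 / δ)) ~[atTop] fun N : ℕ => Real.log N :=
    IsEquivalent.refl.add_isLittleO
      ((Real.isLittleO_const_log_atTop).comp_tendsto tendsto_natCast_atTop_atTop)
  exact h1.trans_isTheta h2.isTheta

theorem isTheta_sampleBound {r : ℝ} (hr : |r| < 1) {ε δ : ℝ} (hε : 0 < ε) (hδ : 0 < δ)
    (hδ1 : δ < 1) {c : ℝ} (hc : 0 < c) :
    (fun N : ℕ => sampleBound (c * N) r N ε δ) =Θ[atTop]
      fun N : ℕ => (N : ℝ) ^ 4 * Real.log N * ((1 + |r|) / (1 - |r|)) ^ (2 * N) := by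
  have h1r : 0 < 1 - |r| ^ 2 := by nlinarith [abs_nonneg r]
  refine (isEquivalent_sampleBound hr hε hδ hδ1 hc).isTheta.trans ?_
  set C : ℝ := 32 * c ^ 2 / (Real.pi ^ 4 * ε ^ 2 * (1 - |r| ^ 2) ^ 2) with hC
  have hC0 : C ≠ 0 := by positivity
  have h := ((isTheta_refl (fun N : ℕ => (N : ℝ) ^ 4 * ((1 + |r|) / (1 - |r|)) ^ (2 * N))
    atTop).mul (isTheta_log hδ)).const_mul_left hC0
  refine ((EventuallyEq.of_eq ?_).trans_isTheta h).trans_eventuallyEq (EventuallyEq.of_eq ?_)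
  · funext N; rw [hC]; ring
  · funext N; ring

theorem sampleBound_zero_bounds {A : ℝ} (hA : 1 ≤ A) {N : ℕ} (hN : 1 ≤ N) {ε δ : ℝ} (hε : 0 < ε)
    (hε1 : ε < 1) (hδ : 0 < δ) (hδ1 : δ < 1) :
    1 / 4 * ((N : ℝ) ^ 2 * A ^ 2 / ε ^ 2 * Real.log (2 * N / δ)) ≤ sampleBound A 0 N ε δ ∧
      sampleBound A 0 N ε δ ≤ 2 * ((N : ℝ) ^ 2 * A ^ 2 / ε ^ 2 * Real.log (2 * N / δ)) := by
  have hlog := log_pos hN hδ hδ1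
  have hN' : (1 : ℝ) ≤ N := by exact_mod_cast hN
  have hr : |(0 : ℝ)| < 1 := by simp
  set l := level 0 N with hl
  have hl' : l = 4 / Real.pi ^ 2 := by rw [hl, level_eq hr]; simp [growth]
  have hl1 : l ≤ 41 / 100 := by
    rw [hl', div_le_iff₀ (by positivity)]
    nlinarith [Real.pi_gt_d2]
  have hl2 : 39 / 100 ≤ l := by
    rw [hl', le_div_iff₀ (by positivity)]
    nlinarith [Real.pi_lt_d2, Real.pi_gt_three]
  have hs : sampleBound A 0 N ε δ =
      (2 * ((N : ℝ) ^ 2 * A ^ 2 * l ^ 2) + N * A * (l + 1) * ε) / ε ^ 2 *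
        Real.log (2 * N / δ) := by
    rw [sampleBound, rangeBound_eq_level, varianceBound_eq_level _ hr, ← hl]
    field_simp
  have hNA : 1 ≤ N * A := by nlinarith
  have he : ∀ k : ℝ, k * ((N : ℝ) ^ 2 * A ^ 2 / ε ^ 2 * Real.log (2 * N / δ)) =
      k * ((N : ℝ) ^ 2 * A ^ 2) / ε ^ 2 * Real.log (2 * N / δ) := fun k => by ring
  rw [hs, he, he]
  have hNA2 : N * A * ε ≤ (N * A) ^ 2 := by nlinarith
  have hl3 : l ^ 2 ≤ 17 / 100 := by nlinarith
  have hl4 : 15 / 100 ≤ l ^ 2 := by nlinarith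
  constructor
  · gcongr
    have h5 : 0 ≤ N * A * (l + 1) * ε := by positivity
    nlinarith [mul_le_mul_of_nonneg_left hl4 (sq_nonneg ((N : ℝ) * A))]
  · gcongr
    nlinarith [mul_le_mul_of_nonneg_left hl3 (sq_nonneg ((N : ℝ) * A)),
      mul_le_mul_of_nonneg_left hNA2 (by linarith : 0 ≤ l + 1),
      mul_le_mul_of_nonneg_left hl1 (sq_nonneg ((N : ℝ) * A))]

/-! ### The heterodyne limit -/

theorem tendsto_growth : Tendsto growth (𝓝[>] (-1)) atTop := by
  have h1 : Tendsto (fun s : ℝ => 1 + |s|) (𝓝[>] (-1)) (𝓝 2) := by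
    have : Tendsto (fun s : ℝ => 1 + |s|) (𝓝 (-1)) (𝓝 (1 + |(-1 : ℝ)|)) :=
      (continuous_const.add continuous_abs).tendsto _
    norm_num at this
    exact this.mono_left nhdsWithin_le_nhds
  have h2 : Tendsto (fun s : ℝ => 1 - |s|) (𝓝[>] (-1)) (𝓝[>] 0) := by
    rw [tendsto_nhdsWithin_iff]
    constructor
    · have : Tendsto (fun s : ℝ => 1 - |s|) (𝓝 (-1)) (𝓝 (1 - |(-1 : ℝ)|)) :=
        (continuous_const.sub continuous_abs).tendsto _
      norm_num at this
      exact this.mono_left nhdsWithin_le_nhds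
    · filter_upwards [Ioo_mem_nhdsGT (show (-1 : ℝ) < 0 by norm_num)] with s hs
      simp only [Set.mem_Ioi]
      rw [abs_of_neg hs.2]; linarith [hs.1]
  have h3 := Tendsto.pos_mul_atTop two_pos h1 (tendsto_inv_nhdsGT_zero.comp h2)
  exact h3

theorem eventually_abs_lt_one : ∀ᶠ s : ℝ in 𝓝[>] (-1), |s| < 1 := by
  filter_upwards [Ioo_mem_nhdsGT (show (-1 : ℝ) < 1 by norm_num)] with s hs
  exact abs_lt.mpr hs

theorem tendsto_sampleBound {A : ℝ} (hA : 0 < A) {N : ℕ} (hN : 1 ≤ N) {ε δ : ℝ}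
    (hε : 0 < ε) (hδ : 0 < δ) (hδ1 : δ < 1) :
    Tendsto (fun s : ℝ => sampleBound A s N ε δ) (𝓝[>] (-1)) atTop := by
  have hlog := log_pos hN hδ hδ1
  have hN0 : (0 : ℝ) < N := by exact_mod_cast hN
  have h1 : Tendsto (fun s => 32 * (N : ℝ) ^ 2 * A ^ 2 / (Real.pi ^ 4 * ε ^ 2) *
      Real.log (2 * N / δ) * growth s ^ (2 * N)) (𝓝[>] (-1)) atTop :=
    ((tendsto_pow_atTop (by omega)).comp tendsto_growth).const_mul_atTop (by positivity)
  refine tendsto_atTop_mono' _ ?_ h1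
  filter_upwards [eventually_abs_lt_one] with s hs
  exact le_sampleBound hA.le hs hN hε hδ hδ1

theorem isLittleO_pow_sampleBound {c : ℝ} (hc : 0 < c) {s : ℕ → ℝ} (hs : ∀ N, -1 < s N)
    (hs1 : Tendsto s atTop (𝓝 (-1))) {ε δ : ℝ} (hε : 0 < ε) (hδ : 0 < δ) (hδ1 : δ < 1) (K : ℝ) :
    (fun N : ℕ => K ^ N) =o[atTop] fun N : ℕ => sampleBound (c * N) (s N) N ε δ := by
  have hs' : Tendsto s atTop (𝓝[>] (-1)) :=
    tendsto_nhdsWithin_iff.mpr ⟨hs1, .of_forall hs⟩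
  have hg := tendsto_growth.comp hs'
  have hlog : 0 < Real.log (2 / δ) := Real.log_pos (by rw [lt_div_iff₀ hδ]; linarith)
  refine (isLittleO_pow_pow_of_abs_lt_left (r₂ := |K| + 1)
    (by rw [abs_of_nonneg (by positivity : 0 ≤ |K| + 1)]; linarith)).trans_isBigO ?_
  set C : ℝ := 32 * c ^ 2 / (Real.pi ^ 4 * ε ^ 2) * Real.log (2 / δ) with hC
  have hC0 : 0 < C := by positivity
  refine IsBigO.of_bound C⁻¹ ?_
  filter_upwards [eventually_ge_atTop 1, hs'.eventually eventually_abs_lt_one,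
    hg.eventually_ge_atTop (|K| + 1)] with N hN hsN hgN
  have hN' : (1 : ℝ) ≤ N := by exact_mod_cast hN
  simp only [Function.comp_apply] at hgN
  have hg1 := one_le_growth hsN
  have h1 := le_sampleBound (A := c * N) (by positivity) hsN hN hε hδ hδ1
  have h2 : C * growth (s N) ^ (2 * N) ≤ 32 * (N : ℝ) ^ 2 * (c * N) ^ 2 / (Real.pi ^ 4 * ε ^ 2) *
      Real.log (2 * N / δ) * growth (s N) ^ (2 * N) := by
    rw [hC]
    have h3 : c ^ 2 ≤ (N : ℝ) ^ 2 * (c * N) ^ 2 := by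
      have h4 : (1 : ℝ) ≤ (N : ℝ) ^ 4 := one_le_pow₀ hN'
      nlinarith [sq_nonneg c]
    rw [mul_assoc 32 ((N : ℝ) ^ 2)]
    gcongr
    linarith
  have h5 : (|K| + 1) ^ N ≤ growth (s N) ^ (2 * N) :=
    (pow_le_pow_left₀ (by positivity) hgN N).trans (pow_le_pow_right₀ hg1 (by omega))
  have h6 : 0 ≤ sampleBound (c * N) (s N) N ε δ :=
    le_trans (by positivity) (h2.trans h1)
  rw [Real.norm_eq_abs, Real.norm_eq_abs, abs_of_nonneg (by positivity), abs_of_nonneg h6,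
    le_inv_mul_iff₀ hC0]
  exact (mul_le_mul_of_nonneg_left h5 hC0.le).trans (h2.trans h1)

theorem tendsto_dualMatrix_entry (α : ℂ) (i j : ℕ) :
    Tendsto (fun s : ℝ => ∑' n, tTerm (-s) α i j n) (𝓝[>] (-1))
      (𝓝 ((Real.pi : ℂ)⁻¹ * (inner ℂ (fock i) (displacedFock α 0) *
        inner ℂ (displacedFock α 0) (fock j)))) := by
  have hlim : (Real.pi : ℂ)⁻¹ * (inner ℂ (fock i) (displacedFock α 0) *
        inner ℂ (displacedFock α 0) (fock j)) = ∑' n, tTerm 1 α i j n := by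
    rw [tsum_eq_single 0]
    · have h2 : eig 1 0 = Real.pi⁻¹ := by
        rw [eig]; field_simp; norm_num
      rw [tTerm, h2]; push_cast; rfl
    · intro n hn
      simp [tTerm, eig, hn]
  rw [hlim]
  have hsum := ((summable_norm_mul_displacedFock α 1 i j).mul_left (2 / Real.pi))
  refine tendsto_tsum_of_dominated_convergence hsum (fun n => ?_) ?_
  · refine Tendsto.mul_const _ ?_
    refine (Complex.continuous_ofReal.tendsto _).comp ?_
    have hc : ContinuousAt (fun s : ℝ => eig (-s) n) (-1) := by
      unfold eig
      refine ContinuousAt.div (by fun_prop) (by fun_prop) ?_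
      norm_num [Real.pi_ne_zero]
    have := hc.tendsto
    rw [neg_neg] at this
    exact this.mono_left nhdsWithin_le_nhds
  · filter_upwards [Ioo_mem_nhdsGT (show (-1 : ℝ) < 0 by norm_num)] with s hs n
    rw [tTerm_eq, one_pow, one_mul, norm_mul, norm_mul]
    have h1 : (0 : ℝ) < 1 - s := by linarith [hs.2]
    have h2 : (0 : ℝ) < 1 + s := by linarith [hs.1]
    rw [Complex.norm_real, norm_pow, Complex.norm_real, Real.norm_eq_abs, Real.norm_eq_abs,
      abs_neg, sub_neg_eq_add, ← sub_eq_add_neg,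
      abs_of_nonneg (a := 2 / (Real.pi * (1 - s))) (by positivity),
      abs_of_nonneg (a := (1 + s) / (1 - s)) (by positivity)]
    have h3 : (1 + s) / (1 - s) ≤ 1 := by rw [div_le_one h1]; linarith [hs.2]
    have h4 : 2 / (Real.pi * (1 - s)) ≤ 2 / Real.pi := by
      gcongr
      exact le_mul_of_one_le_right Real.pi_pos.le (by linarith [hs.2])
    refine mul_le_mul h4 ?_ (by positivity) (by positivity)
    exact mul_le_of_le_one_left (norm_nonneg _) (pow_le_one₀ (by positivity) h3)

theorem tendsto_dualMatrix (N : ℕ) (α : ℂ) :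
    Tendsto (fun s : ℝ => dualMatrix s N α) (𝓝[>] (-1))
      (𝓝 (Matrix.of fun i j : Fin N => (Real.pi : ℂ)⁻¹ *
        (inner ℂ (fock i) (displacedFock α 0) * inner ℂ (displacedFock α 0) (fock j)))) :=
  tendsto_pi_nhds.mpr fun i => tendsto_pi_nhds.mpr fun j => tendsto_dualMatrix_entry α i j

end PNR

theorem mainTheorem2
    (r : ℝ) (hr : |r| < 1) (ε δ : ℝ) (hε : 0 < ε) (hε1 : ε < 1) (hδ : 0 < δ) (hδ1 : δ < 1) :
    -- the objects are well defined
    (∀ (α : ℂ) (n : ℕ), Summable (PNR.displacementTerm α n)) ∧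
    (∀ α : ℂ, Orthonormal ℂ (PNR.displacedFock α)) ∧
    (∀ (α : ℂ) (i j : ℕ), Summable (PNR.tTerm r α i j)) ∧
    -- shadow norms and sample size, for PNR shadows and, at `r = 0`, photon-parity shadows
    (∀ (ρ : PNR.Fock →L[ℂ] PNR.Fock) (𝒜 : Set ℂ) (κ A : ℝ) (N : ℕ) (M : ℕ∞),
      PNR.IsDensityOperator ρ → MeasurableSet 𝒜 → volume 𝒜 ≠ 0 → volume 𝒜 ≠ ∞ →
      0 < κ → A = κ * (volume 𝒜).toReal → 1 ≤ N → (M = N ∨ (r = 0 ∧ M = ⊤)) →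
      IsProbabilityMeasure (PNR.outcomeLaw ρ 𝒜) ∧
      Integrable (PNR.snapshot A r N M) (PNR.outcomeLaw ρ 𝒜) ∧
      Integrable (fun x => PNR.snapshot A r N M x ^ 2) (PNR.outcomeLaw ρ 𝒜) ∧
      ∫ x, PNR.snapshot A r N M x ∂(PNR.outcomeLaw ρ 𝒜) = PNR.truncExpansion κ r N M ρ 𝒜 ∧
      -- the norm of a snapshot
      (∀ x : ℕ × ℂ,
        ‖PNR.snapshot A r N M x‖ ≤ A * |PNR.eig (-|r|) N * PNR.eig |r| 0|) ∧
      -- the shadow norm `R`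
      (∀ x : ℕ × ℂ, ‖PNR.snapshot A r N M x - PNR.truncExpansion κ r N M ρ 𝒜‖ ≤
        2 * (A * |PNR.eig (-|r|) N * PNR.eig |r| 0|)) ∧
      (1 ≤ A → ∀ x : ℕ × ℂ,
        ‖PNR.snapshot A r N M x - PNR.truncState N ρ‖ ≤ PNR.rangeBound A r N) ∧
      -- the shadow norm `ν²`
      ‖∫ x, PNR.snapshot A r N M x ^ 2 ∂(PNR.outcomeLaw ρ 𝒜)‖ ≤
        A ^ 2 * |PNR.eig |r| 0 * PNR.eig (-|r|) N| ^ 2 ∧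
      A ^ 2 * |PNR.eig |r| 0 * PNR.eig (-|r|) N| ^ 2 = PNR.varianceBound A r N ∧
      -- the number of samples
      (∀ T : ℕ, PNR.sampleBound A r N ε δ ≤ T →
        ENNReal.ofReal (1 - δ) ≤ Measure.pi (fun _ : Fin T => PNR.outcomeLaw ρ 𝒜)
          {x | ‖PNR.shadow A r N M x - PNR.truncExpansion κ r N M ρ 𝒜‖ ≤ ε} ∧
        ENNReal.ofReal (1 - δ) ≤ Measure.pi (fun _ : Fin T => PNR.outcomeLaw ρ 𝒜)
          {x | ‖PNR.shadow A r N M x - PNR.truncState N ρ‖ ≤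
            ε + ‖PNR.truncExpansion κ r N M ρ 𝒜 - PNR.truncState N ρ‖})) ∧
    -- growth of the sample size for `A = c N`
    (∀ c : ℝ, 0 < c →
      (fun N : ℕ => PNR.sampleBound (c * N) r N ε δ) ~[atTop]
        fun N : ℕ => 32 * c ^ 2 * (N : ℝ) ^ 4 / (Real.pi ^ 4 * ε ^ 2 * (1 - |r| ^ 2) ^ 2) *
          ((1 + |r|) / (1 - |r|)) ^ (2 * N) * Real.log (2 * N / δ)) ∧
    -- the case `r = 0`
    (∀ (A : ℝ) (N : ℕ), 1 ≤ A → 1 ≤ N →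
      1 / 4 * ((N : ℝ) ^ 2 * A ^ 2 / ε ^ 2 * Real.log (2 * N / δ)) ≤
        PNR.sampleBound A 0 N ε δ ∧
      PNR.sampleBound A 0 N ε δ ≤ 2 * ((N : ℝ) ^ 2 * A ^ 2 / ε ^ 2 * Real.log (2 * N / δ))) ∧
    (∀ c : ℝ, 0 < c → (fun N : ℕ => PNR.sampleBound (c * N) 0 N ε δ) =O[atTop]
      fun N : ℕ => (N : ℝ) ^ 4 * Real.log N) ∧
    -- the case `0 < |r| < 1`
    (r ≠ 0 → 1 < (1 + |r|) / (1 - |r|) ∧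
      ∀ c : ℝ, 0 < c → (fun N : ℕ => PNR.sampleBound (c * N) r N ε δ) =Θ[atTop]
        fun N : ℕ => (N : ℝ) ^ 4 * Real.log N * ((1 + |r|) / (1 - |r|)) ^ (2 * N)) ∧
    -- the heterodyne limit `r → -1`
    (∀ (N : ℕ) (α : ℂ), Tendsto (fun s : ℝ => PNR.dualMatrix s N α) (𝓝[>] (-1))
      (𝓝 (Matrix.of fun i j : Fin N => (Real.pi : ℂ)⁻¹ *
        (inner ℂ (PNR.fock i) (PNR.displacedFock α 0) *
          inner ℂ (PNR.displacedFock α 0) (PNR.fock j))))) ∧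
    (∀ (A : ℝ) (N : ℕ), 0 < A → 1 ≤ N →
      Tendsto (fun s : ℝ => PNR.sampleBound A s N ε δ) (𝓝[>] (-1)) atTop) ∧
    (∀ (c : ℝ) (s : ℕ → ℝ), 0 < c → (∀ N, -1 < s N) → Tendsto s atTop (𝓝 (-1)) →
      ∀ K : ℝ, (fun N : ℕ => K ^ N) =o[atTop]
        fun N : ℕ => PNR.sampleBound (c * N) (s N) N ε δ) := by
  refine ⟨PNR.summable_displacementTerm, PNR.orthonormal_displacedFock, PNR.summable_tTerm r, ?_,
    fun c hc => PNR.isEquivalent_sampleBound hr hε hδ hδ1 hc,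
    fun A N hA hN => PNR.sampleBound_zero_bounds hA hN hε hε1 hδ hδ1, fun c hc => ?_, fun hr0 => ?_,
    PNR.tendsto_dualMatrix, fun A N hA hN => PNR.tendsto_sampleBound hA hN hε hδ hδ1,
    fun c s hc hs hs1 K => PNR.isLittleO_pow_sampleBound hc hs hs1 hε hδ hδ1 K⟩
  · intro ρ 𝒜 κ A N M hρ _ h0 hfin hκ hA hN hM
    have hA0 : 0 < A := by
      rw [hA]
      exact mul_pos hκ (ENNReal.toReal_pos h0 hfin)
    have hprob := PNR.isProbabilityMeasure_outcomeLaw hρ h0 hfin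
    have hE := PNR.integral_snapshot hρ h0 hfin hκ hA hr hM
    have hsnap : ∀ x, ‖PNR.snapshot A r N M x‖ ≤ A * |PNR.eig (-|r|) N * PNR.eig |r| 0| :=
      fun x => (PNR.norm_snapshot_le hA0.le hr hM x).trans
        (PNR.snapBound_le_mul_abs_eig hA0.le hr hN)
    have hmean : ‖PNR.truncExpansion κ r N M ρ 𝒜‖ ≤ A * |PNR.eig (-|r|) N * PNR.eig |r| 0| := by
      rw [← hE]
      simpa using norm_integral_le_of_norm_le_const (μ := PNR.outcomeLaw ρ 𝒜) (.of_forall hsnap)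
    have hsq : ∀ x, ‖PNR.snapshot A r N M x ^ 2‖ ≤
        A ^ 2 * |PNR.eig |r| 0 * PNR.eig (-|r|) N| ^ 2 := fun x => by
      rw [mul_comm (PNR.eig |r| 0), ← mul_pow]
      exact (norm_pow_le' _ two_pos).trans (pow_le_pow_left₀ (norm_nonneg _) (hsnap x) 2)
    have hconc : ∀ T : ℕ, PNR.sampleBound A r N ε δ ≤ T →
        ENNReal.ofReal (1 - δ) ≤ Measure.pi (fun _ : Fin T => PNR.outcomeLaw ρ 𝒜)
          {x | ‖PNR.shadow A r N M x - PNR.truncExpansion κ r N M ρ 𝒜‖ ≤ ε} := fun T hT => by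
      rw [← hE]
      exact PNR.le_measure_norm_shadow_sub_le hA0 hr hN hM hε hδ hδ1 hT
    refine ⟨hprob, PNR.integrable_snapshot hA0.le hr hM _, ?_, hE, hsnap, fun x => ?_,
      fun hA1 x => ?_, ?_, PNR.sq_mul_abs_eig_eq_varianceBound hr N,
      fun T hT => ⟨hconc T hT, (hconc T hT).trans (measure_mono fun x hx => ?_)⟩⟩
    · exact .of_bound ((PNR.stronglyMeasurable_snapshot A r N M).pow 2).aestronglyMeasurable _
        (.of_forall hsq)
    · linarith [norm_sub_le (PNR.snapshot A r N M x) (PNR.truncExpansion κ r N M ρ 𝒜), hsnap x]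
    · rw [PNR.rangeBound_eq_level]
      exact (norm_sub_le _ _).trans
        (add_le_add (hsnap x) ((PNR.norm_truncState_le_one hρ N).trans hA1))
    · simpa using norm_integral_le_of_norm_le_const (μ := PNR.outcomeLaw ρ 𝒜) (.of_forall hsq)
    · refine (norm_sub_le_norm_sub_add_norm_sub _ (PNR.truncExpansion κ r N M ρ 𝒜) _).trans ?_
      gcongr
      exact hx
  · simpa using (PNR.isTheta_sampleBound (r := 0) (by simp) hε hδ hδ1 hc).isBigO
  · refine ⟨?_, fun c hc => PNR.isTheta_sampleBound hr hε hδ hδ1 hc⟩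
    rw [one_lt_div (by linarith)]
    linarith [abs_pos.mpr hr0]
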